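/- Fix a dimension $D\ge 2$. There are constants $c,c'>0$, depending only on $D$, such that the following holds. Let $\Lambda$ be the $D$-dimensional cubic lattice of linear size $L$ with the Euclidean distance, each axis being either open or periodic, with one qubit on each of its $n=L^D$ sites, and let $\Pi$ be the orthogonal projector onto a code subspace of $(\mathbb C^2)^{\otimes n}$. Let $\delta\ge 0$, let $\ell\ge 1$ be real and let $1\le d\le n$ be an integer. Suppose that $\Pi$ is a $(\delta,\ell)$-correctable code of distance $d$, meaning that every region $A\subseteq\Lambda$ with $|A|<d$ is $(\delta,\ell)$-correctable: if $AB=A^{+\ell}$ is the set of sites within distance $\ell$ of $A$ and $C$ is its complement, there is a quantum channel $\mathcal R$ from $B$ to $AB$ such that $$\mathfrak B\bigl((\mathcal R\otimes\mathrm{id}_{CR})(\rho^{BCR}),\rho^{ABCR}\bigr)\le\delta$$ for every density operator $\rho^{ABC}$ with $\Pi\rho^{ABC}=\rho^{ABC}=\rho^{ABC}\Pi$ and every purification $\rho^{ABCR}$ of it by a finite-dimensional system $R$. Here $\mathfrak B(\rho,\sigma)=\sqrt{1-\operatorname{Tr}\sqrt{\sqrt\sigma\,\rho\sqrt\sigma}}$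 is the Bures distance. Then there is a region $Y\subseteq\Lambda$ with $\tilde d=|Y|$ sites such that $$\tilde d\, d^{\frac1{D-1}}\le c'\, n\,\ell^{\frac D{D-1}},$$ and such that for every logical operator $U$ (an operator that commutes with $\Pi$) with operator norm $\|U\|\le 1$, in particular for every logical unitary, there is an operator $V$ supported on $Y$ with $$\|(U-V)\Pi\|\le c\,\sqrt{n\delta/d}.$$ -/

import Mathlib

namespace LocalCode

/-! ## The lattice -/

/-- The sites of the `D`-dimensional cubic lattice of linear size `L`; there are `L ^ D` of them. -/
abbrev Site (D L : ℕ) : Type := Fin D → Fin L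

/-- Separation of two coordinates along one axis: `|a - b|` if the axis is open, and the
distance `min (|a - b|) (L - |a - b|)` around a circle of length `L` if it is periodic. -/
noncomputable def axisDist {L : ℕ} (periodic : Bool) (a b : Fin L) : ℝ :=
  if periodic then min |(a : ℝ) - (b : ℝ)| ((L : ℝ) - |(a : ℝ) - (b : ℝ)|)
  else |(a : ℝ) - (b : ℝ)|

/-- Euclidean distance of two sites; `bc i = true` means that the `i`-th axis is periodic. -/
noncomputable def siteDist {D L : ℕ} (bc : Fin D → Bool) (x y : Site D L) : ℝ :=
  Real.sqrt (∑ i, axisDist (bc i) (x i) (y i) ^ 2)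

open Classical in
/-- The region `A^{+ℓ}` of all sites within distance `ℓ` of `A`. -/
noncomputable def nbhd {D L : ℕ} (bc : Fin D → Bool) (ℓ : ℝ) (A : Finset (Site D L)) :
    Finset (Site D L) :=
  Finset.univ.filter (fun x => ∃ a ∈ A, siteDist bc a x ≤ ℓ)

/-! ## States, channels, Bures distance -/

section States

open scoped ComplexOrder

/-- Computational basis labels of the qubits in a region `S`; operators of the region are
matrices indexed by `Cfg S`. -/
abbrev Cfg {Λ : Type} (S : Finset Λ) : Type := S → Fin 2

/-- Density matrices. -/
def IsDensity {ι : Type} [Fintype ι] (ρ : Matrix ι ι ℂ) : Prop :=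
  ρ.PosSemidef ∧ ρ.trace = 1

/-- The rank one matrix `|ψ⟩⟨ψ|`. -/
def pureState {ι : Type} (ψ : ι → ℂ) : Matrix ι ι ℂ :=
  Matrix.vecMulVec ψ (star ψ)

/-- Partial trace over the second tensor factor. -/
def traceRight {ι κ : Type} [Fintype κ] (ρ : Matrix (ι × κ) (ι × κ) ℂ) : Matrix ι ι ℂ :=
  Matrix.of fun x y => ∑ a, ρ (x, a) (y, a)

/-- The map `Φ ⊗ id` on matrices with a second tensor factor `κ`. -/
def ampliation {ι ι' : Type} (Φ : Matrix ι ι ℂ →ₗ[ℂ] Matrix ι' ι' ℂ) {κ : Type}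
    (X : Matrix (ι × κ) (ι × κ) ℂ) : Matrix (ι' × κ) (ι' × κ) ℂ :=
  Matrix.of fun p q => Φ (Matrix.of fun i j => X (i, p.2) (j, q.2)) p.1 q.1

/-- Quantum channels: completely positive trace preserving linear maps. -/
structure IsChannel {ι ι' : Type} [Fintype ι] [Fintype ι']
    (Φ : Matrix ι ι ℂ →ₗ[ℂ] Matrix ι' ι' ℂ) : Prop where
  completelyPositive : ∀ (k : ℕ) (X : Matrix (ι × Fin k) (ι × Fin k) ℂ),
    X.PosSemidef → (ampliation Φ X).PosSemidef
  tracePreserving : ∀ X : Matrix ι ι ℂ, (Φ X).trace = X.trace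

open scoped MatrixOrder in
/-- The fidelity `Tr √(√σ ρ √σ)`. -/
noncomputable def fidelity {ι : Type} [Fintype ι] [DecidableEq ι] (ρ σ : Matrix ι ι ℂ) : ℝ :=
  (CFC.sqrt (CFC.sqrt σ * ρ * CFC.sqrt σ)).trace.re

/-- The Bures distance `√(1 - F)`. -/
noncomputable def bures {ι : Type} [Fintype ι] [DecidableEq ι] (ρ σ : Matrix ι ι ℂ) : ℝ :=
  Real.sqrt (1 - fidelity ρ σ)

end States

/-! ## Regions of qubits -/

section Regions

variable {Λ : Type} [Fintype Λ] [DecidableEq Λ]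

/-- Restriction of a basis label of the whole lattice to a region. -/
def restrictCfg (S : Finset Λ) (x : Λ → Fin 2) : Cfg S := fun i => x i

/-- For `A ⊆ N`, the basis label of the lattice with given restrictions to `A`, to `N \ A` and to
the complement of `N`. -/
def glue (A N : Finset Λ) (α : Cfg A) (β : Cfg (N \ A)) (γ : Cfg Nᶜ) : Λ → Fin 2 :=
  fun x =>
    if hA : x ∈ A then α ⟨x, hA⟩
    else if hN : x ∈ N then β ⟨x, Finset.mem_sdiff.2 ⟨hN, hA⟩⟩
    else γ ⟨x, Finset.mem_compl.2 hN⟩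

/-- With `B = N \ A` and `C = Nᶜ`: the partial trace `ρ^{BCR}` of `ρ = ρ^{ABCR}` over `A`, written
on `B ⊗ (C ⊗ R)`. -/
def eraseRegion (A N : Finset Λ) {κ : Type}
    (ρ : Matrix ((Λ → Fin 2) × κ) ((Λ → Fin 2) × κ) ℂ) :
    Matrix (Cfg (N \ A) × (Cfg Nᶜ × κ)) (Cfg (N \ A) × (Cfg Nᶜ × κ)) ℂ :=
  Matrix.of fun p q => ∑ α : Cfg A, ρ (glue A N α p.1 p.2.1, p.2.2) (glue A N α q.1 q.2.1, q.2.2)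

/-- A state on `N ⊗ (Nᶜ ⊗ R)` read as a state on `Λ ⊗ R`. -/
def assemble (N : Finset Λ) {κ : Type}
    (σ : Matrix (Cfg N × (Cfg Nᶜ × κ)) (Cfg N × (Cfg Nᶜ × κ)) ℂ) :
    Matrix ((Λ → Fin 2) × κ) ((Λ → Fin 2) × κ) ℂ :=
  Matrix.of fun p q => σ (restrictCfg N p.1, (restrictCfg Nᶜ p.1, p.2))
    (restrictCfg N q.1, (restrictCfg Nᶜ q.1, q.2))

/-- `V` acts on the qubits of `Y` only: `V = O ⊗ 1` for an operator `O` of the region `Y`. -/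
def SupportedOn (Y : Finset Λ) (V : Matrix (Λ → Fin 2) (Λ → Fin 2) ℂ) : Prop :=
  ∃ O : Matrix (Cfg Y) (Cfg Y) ℂ, ∀ x y, V x y =
    if restrictCfg Yᶜ x = restrictCfg Yᶜ y then O (restrictCfg Y x) (restrictCfg Y y) else 0

/-- `ρ` is a code state of the code with projector `P`. -/
def IsCodeState (P ρ : Matrix (Λ → Fin 2) (Λ → Fin 2) ℂ) : Prop :=
  IsDensity ρ ∧ P * ρ = ρ ∧ ρ * P = ρ

/-- A single channel `R` from `B = N \ A` to `AB = N` recovers every code state, together with any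
purifying system, from the erasure of `A`, up to Bures distance `δ`. -/
def RecoverableWithin (P : Matrix (Λ → Fin 2) (Λ → Fin 2) ℂ) (δ : ℝ) (A N : Finset Λ) : Prop :=
  ∃ R : Matrix (Cfg (N \ A)) (Cfg (N \ A)) ℂ →ₗ[ℂ] Matrix (Cfg N) (Cfg N) ℂ, IsChannel R ∧
    ∀ ρ, IsCodeState P ρ → ∀ (r : ℕ) (ψ : (Λ → Fin 2) × Fin r → ℂ),
      traceRight (pureState ψ) = ρ →
        bures (assemble N (ampliation R (eraseRegion A N (pureState ψ)))) (pureState ψ) ≤ δ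

end Regions

/-- The region `A` is `(δ, ℓ)`-correctable on the code with projector `P`. -/
def IsCorrectable {D L : ℕ} (bc : Fin D → Bool)
    (P : Matrix (Site D L → Fin 2) (Site D L → Fin 2) ℂ) (δ ℓ : ℝ) (A : Finset (Site D L)) :
    Prop :=
  RecoverableWithin P δ A (nbhd bc ℓ A)

/-- The code with projector `P` is a `(δ, ℓ)`-correctable code of distance `d`: every region of
size less than `d` is `(δ, ℓ)`-correctable. -/
def IsCorrectableCode {D L : ℕ} (bc : Fin D → Bool)
    (P : Matrix (Site D L → Fin 2) (Site D L → Fin 2) ℂ) (δ ℓ : ℝ) (d : ℕ) : Prop :=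
  ∀ A : Finset (Site D L), A.card < d → IsCorrectable bc P δ ℓ A

/-- An operator is logical if it commutes with the code projector. -/
def IsLogical {ι : Type} [Fintype ι] (P U : Matrix ι ι ℂ) : Prop := Commute U P

end LocalCode

open scoped Matrix.Norms.L2Operator

open scoped Matrix.Norms.L2Operator

/-! The argument is run in the Heisenberg picture. A region is cleaned by a unital Schwarz map `T`
making every operator trivial there. If `‖P (T X - X) P‖ ≤ ε ‖X‖` for all `X`, the Schwarz
inequality applied to a logical `U` gives `‖(U - T U) P‖ ≤ √(3ε)`
(`IsUnitalSchwarz.norm_sub_mul_le`), so `V = T U` serves for every `U` once one `T` cleans the whole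
complement of `Y`.

Correctability of `A` supplies two maps with error `20δ` (`RecoverableWithin.cleanable`). Erasing
`A` and recovering from `B` is an operation whose Stinespring isometry sends each code vector `ψ`
close to some `φ ⊗ ψ`; linearity makes `φ` independent of `ψ` (`exists_uniform_factor`). The dual of
this operation cleans `A` and acts only on the neighborhood of `A`. Exchanging the erased qubits
with the environment turns it into an operation on `B` alone, and turns `φ ⊗ 1` into the replacement
of `A` by a fixed state. The two are close on the code, so this replacement, which acts only on `A`,
almost preserves operators trivial on `B`.

Combining the two kinds of map, a region whose neighborhood lies in its union with a second region
can be merged with that region, errors adding (`LocallyCleanable.union`). A cube thus grows by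
shells of thickness about `ℓ` as long as each shell has fewer than `d` sites, that is, up to linear
size `w` with `ℓ w^(D-1) ~ d`. A grid of such cubes separated by gaps of width about `ℓ` is cleaned
cube by cube, and `Y` is the union of the gaps, with about `n ℓ / w` sites. The number of steps is
`(L / w)^D (w / ℓ) ~ n / d`, hence the error `√(n δ / d)` (`exists_cleanable_compl`). -/

namespace LocalCode

/-! ### Unital Schwarz maps and their action on operators preserving the code. -/

section UnitalSchwarz

open scoped MatrixOrder

/-- A unital linear map on matrices that satisfies the Schwarz inequality. -/
structure IsUnitalSchwarz {n : Type*} [Fintype n] [DecidableEq n]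
    (T : Matrix n n ℂ →ₗ[ℂ] Matrix n n ℂ) : Prop where
  map_one : T 1 = 1
  schwarz : ∀ X, star (T X) * T X ≤ T (star X * X)

/-- The Heisenberg picture of a quantum operation with given Kraus operators. -/
def krausMap {n : Type*} [Fintype n] {ι : Type*} [Fintype ι] (K : ι → Matrix n n ℂ) :
    Matrix n n ℂ →ₗ[ℂ] Matrix n n ℂ :=
  ∑ i, LinearMap.mulLeft ℂ (star (K i)) ∘ₗ LinearMap.mulRight ℂ (K i)

theorem krausMap_apply {n : Type*} [Fintype n] {ι : Type*} [Fintype ι]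
    (K : ι → Matrix n n ℂ) (X : Matrix n n ℂ) :
    krausMap K X = ∑ i, star (K i) * (X * K i) := by
  simp [krausMap]

namespace IsUnitalSchwarz

variable {n : Type*} [Fintype n] [DecidableEq n] {T T' : Matrix n n ℂ →ₗ[ℂ] Matrix n n ℂ}

theorem map_nonneg (hT : IsUnitalSchwarz T) {X : Matrix n n ℂ} (hX : 0 ≤ X) : 0 ≤ T X := by
  obtain ⟨Y, rfl⟩ := CStarAlgebra.nonneg_iff_eq_star_mul_self.mp hX
  exact (star_mul_self_nonneg _).trans (hT.schwarz Y)

theorem monotone (hT : IsUnitalSchwarz T) {X Y : Matrix n n ℂ} (h : X ≤ Y) : T X ≤ T Y := by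
  have := hT.map_nonneg (sub_nonneg.2 h)
  rwa [map_sub, sub_nonneg] at this

theorem comp (hT : IsUnitalSchwarz T) (hT' : IsUnitalSchwarz T') :
    IsUnitalSchwarz (T ∘ₗ T') where
  map_one := by simp [hT.map_one, hT'.map_one]
  schwarz X := (hT.schwarz (T' X)).trans (hT.monotone (hT'.schwarz X))

theorem norm_map_le (hT : IsUnitalSchwarz T) (X : Matrix n n ℂ) : ‖T X‖ ≤ ‖X‖ := by
  have h1 : star (T X) * T X ≤ algebraMap ℝ (Matrix n n ℂ) (‖X‖ ^ 2) := by
    refine (hT.schwarz X).trans ?_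
    have := hT.monotone (CStarAlgebra.star_mul_le_algebraMap_norm_sq (a := X))
    rwa [Algebra.algebraMap_eq_smul_one, ← Complex.coe_smul, map_smul, hT.map_one,
      Complex.coe_smul, ← Algebra.algebraMap_eq_smul_one] at this
  have h2 := CStarAlgebra.norm_le_norm_of_nonneg_of_le (star_mul_self_nonneg _) h1
  rw [CStarRing.norm_star_mul_self, ← sq] at h2
  rcases subsingleton_or_nontrivial (Matrix n n ℂ) with h | h
  · simp [Subsingleton.elim (T X) 0]
  · rw [norm_algebraMap', Real.norm_of_nonneg (sq_nonneg _)] at h2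
    exact (sq_le_sq₀ (norm_nonneg _) (norm_nonneg _)).1 h2

theorem id : IsUnitalSchwarz (LinearMap.id : Matrix n n ℂ →ₗ[ℂ] Matrix n n ℂ) where
  map_one := rfl
  schwarz _ := le_rfl

theorem of_krausMap {ι : Type*} [Fintype ι] {K : ι → Matrix n n ℂ}
    (hK : ∑ i, star (K i) * K i = 1) : IsUnitalSchwarz (krausMap K) where
  map_one := by simp [krausMap_apply, hK]
  schwarz X := by
    rw [← sub_nonneg]
    -- The Schwarz defect is a sum of squares of the twisted commutators `X Kᵢ - Kᵢ T(X)`.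
    have h : krausMap K (star X * X) - star (krausMap K X) * krausMap K X =
        ∑ i, star (X * K i - K i * krausMap K X) * (X * K i - K i * krausMap K X) := by
      have e1 : ∑ i, star (K i) * (star X * (K i * krausMap K X)) =
          star (krausMap K X) * krausMap K X := by
        rw [krausMap_apply, star_sum, Finset.sum_mul]
        simp [mul_assoc]
      have e2 : ∑ i, star (krausMap K X) * (star (K i) * (X * K i)) =
          star (krausMap K X) * krausMap K X := by
        rw [← Finset.mul_sum, ← krausMap_apply]
      have e3 : ∑ i, star (krausMap K X) * (star (K i) * (K i * krausMap K X)) =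
          star (krausMap K X) * krausMap K X := by
        have := congrArg (fun Z => star (krausMap K X) * (Z * krausMap K X)) hK
        simpa [Finset.sum_mul, Finset.mul_sum, mul_assoc] using this
      simp only [star_sub, star_mul, sub_mul, mul_sub, mul_assoc, Finset.sum_sub_distrib]
      rw [e1, e2, e3, krausMap_apply K (star X * X)]
      simp [mul_assoc]
    rw [h]
    exact Finset.sum_nonneg fun i _ => star_mul_self_nonneg _

/-- A unital Schwarz map that almost fixes all operators on a subspace almost fixes, in norm, the
operators preserving the subspace. -/
theorem norm_sub_mul_le (hT : IsUnitalSchwarz T) {P U : Matrix n n ℂ} (hP : IsStarProjection P)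
    {ε : ℝ} (hε0 : 0 ≤ ε) (hε : ∀ X, ‖P * (T X - X) * P‖ ≤ ε * ‖X‖) (hU : Commute U P)
    (hU1 : ‖U‖ ≤ 1) :
    ‖(U - T U) * P‖ ≤ Real.sqrt (3 * ε) := by
  apply Real.le_sqrt_of_sq_le
  have hPP : P * P = P := hP.isIdempotentElem
  have hPs : star P = P := hP.isSelfAdjoint
  have hUs : Commute (star U) P := by
    have := hU.star_star; rwa [hPs] at this
  -- Expand the square and bound its term `(T U)* (T U)` by `T (U* U)`. Three differences of the
  -- form `T X - X` remain; since `U` commutes with `P`, each can be sandwiched between two copies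
  -- of `P`, where the hypothesis applies with `X = U` or `X = U* U`.
  have key : star ((U - T U) * P) * ((U - T U) * P) ≤
      P * (T (star U * U) - star U * U) * P - star U * (P * (T U - U) * P)
        - (P * star (T U - U) * P) * U := by
    have h1 : star U * (P * (T U - U) * P) = P * (star U * (T U - U)) * P := by
      simp only [← mul_assoc, hUs.eq]
    have h2 : (P * star (T U - U) * P) * U = P * (star (T U - U) * U) * P := by
      simp only [mul_assoc, hU.eq]
    have h3 : star ((U - T U) * P) * ((U - T U) * P) =
        star P * (star (U - T U) * (U - T U)) * P := by
      simp only [star_mul, mul_assoc]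
    have h4 := star_left_conjugate_le_conjugate (hT.schwarz U) P
    rw [h1, h2, h3, hPs, ← sub_nonneg]
    rw [hPs, ← sub_nonneg] at h4
    convert h4 using 1
    simp only [star_sub]
    noncomm_ring
  have h5 := CStarAlgebra.norm_le_norm_of_nonneg_of_le (star_mul_self_nonneg _) key
  rw [CStarRing.norm_star_mul_self, ← sq] at h5
  refine h5.trans ?_
  have hb : ‖P * (T U - U) * P‖ ≤ ε * ‖U‖ := hε U
  have hc : ‖P * star (T U - U) * P‖ ≤ ε * ‖U‖ := by
    rw [← norm_star]; simpa [hPs, mul_assoc] using hb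
  have ha : ‖P * (T (star U * U) - star U * U) * P‖ ≤ ε * (‖U‖ * ‖U‖) := by
    rw [← CStarRing.norm_star_mul_self]; exact hε _
  have hd := norm_mul_le (star U) (P * (T U - U) * P)
  have he := norm_mul_le (P * star (T U - U) * P) U
  rw [norm_star] at hd
  have hf := norm_sub_le (P * (T (star U * U) - star U * U) * P - star U * (P * (T U - U) * P))
    ((P * star (T U - U) * P) * U)
  have hg := norm_sub_le (P * (T (star U * U) - star U * U) * P) (star U * (P * (T U - U) * P))
  have h0 := norm_nonneg U
  have hd' : ‖U‖ * ‖P * (T U - U) * P‖ ≤ ‖U‖ * (ε * ‖U‖) := by gcongr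
  have he' : ‖P * star (T U - U) * P‖ * ‖U‖ ≤ (ε * ‖U‖) * ‖U‖ := by gcongr
  have htot : ε * (‖U‖ * ‖U‖) ≤ ε := mul_le_of_le_one_right hε0 (mul_le_one₀ hU1 h0 hU1)
  linarith

end IsUnitalSchwarz

end UnitalSchwarz

/-! ### Operators acting trivially on a site -/

section TrivialAt

variable {Λ : Type} [Fintype Λ] [DecidableEq Λ]

/-- Flip the basis label at a single site. -/
def flipAt (i : Λ) (x : Λ → Fin 2) : Λ → Fin 2 := Function.update x i (1 - x i)

omit [Fintype Λ] in
theorem flipAt_apply_self (i : Λ) (x : Λ → Fin 2) : flipAt i x i = 1 - x i := by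
  simp [flipAt]

omit [Fintype Λ] in
theorem flipAt_apply_ne {i j : Λ} (h : j ≠ i) (x : Λ → Fin 2) : flipAt i x j = x j := by
  simp [flipAt, h]

omit [Fintype Λ] in
theorem flipAt_flipAt (i : Λ) (x : Λ → Fin 2) : flipAt i (flipAt i x) = x := by
  ext j
  by_cases h : j = i
  · subst h; simp [flipAt_apply_self]
  · simp [flipAt_apply_ne h]

/-- `flipAt` as a permutation of the basis labels. -/
def flipEquiv (i : Λ) : (Λ → Fin 2) ≃ (Λ → Fin 2) :=
  ⟨flipAt i, flipAt i, flipAt_flipAt i, flipAt_flipAt i⟩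

/-- The operator `X` acts as the identity on the qubit at `i`. -/
structure TrivialAt (i : Λ) (X : Matrix (Λ → Fin 2) (Λ → Fin 2) ℂ) : Prop where
  eq_zero : ∀ x y, x i ≠ y i → X x y = 0
  flip : ∀ x y, X (flipAt i x) (flipAt i y) = X x y

namespace TrivialAt

variable {i : Λ} {X Y : Matrix (Λ → Fin 2) (Λ → Fin 2) ℂ}

theorem mul (hX : TrivialAt i X) (hY : TrivialAt i Y) : TrivialAt i (X * Y) where
  eq_zero x y h := by
    rw [Matrix.mul_apply]
    refine Finset.sum_eq_zero fun z _ => ?_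
    by_cases hz : x i = z i
    · rw [hY.eq_zero z y (hz ▸ h), mul_zero]
    · rw [hX.eq_zero x z hz, zero_mul]
  flip x y := by
    rw [Matrix.mul_apply, Matrix.mul_apply, ← (flipEquiv i).sum_comp]
    exact Finset.sum_congr rfl fun z _ => congrArg₂ _ (hX.flip x z) (hY.flip z y)

omit [Fintype Λ] in
theorem star (hX : TrivialAt i X) : TrivialAt i (star X) where
  eq_zero x y h := by simp [Matrix.star_apply, hX.eq_zero y x (Ne.symm h)]
  flip x y := by simp [Matrix.star_apply, hX.flip]

omit [Fintype Λ] in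
theorem sum {ι : Type*} {s : Finset ι} {F : ι → Matrix (Λ → Fin 2) (Λ → Fin 2) ℂ}
    (h : ∀ k ∈ s, TrivialAt i (F k)) : TrivialAt i (∑ k ∈ s, F k) where
  eq_zero x y hxy := by
    rw [Matrix.sum_apply]; exact Finset.sum_eq_zero fun k hk => (h k hk).eq_zero x y hxy
  flip x y := by
    simp only [Matrix.sum_apply]; exact Finset.sum_congr rfl fun k hk => (h k hk).flip x y

omit [Fintype Λ] in
-- The pair `(x', y')` is carried to `(x, y)` one site of `S` at a time: at each site both labels
-- stay or both flip.
theorem apply_eq_of_agree {S : Finset Λ} (h : ∀ i ∈ S, TrivialAt i X) :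
    ∀ {x y x' y' : Λ → Fin 2}, (∀ i ∈ S, x i = y i) → (∀ i ∈ S, x' i = y' i) →
      (∀ i ∉ S, x' i = x i) → (∀ i ∉ S, y' i = y i) → X x' y' = X x y := by
  induction S using Finset.induction_on with
  | empty =>
    intro x y x' y' _ _ h1 h2
    rw [funext fun i => h1 i (by simp), funext fun i => h2 i (by simp)]
  | insert j S hj ih =>
    intro x y x' y' hxy hxy' hx hy
    have step : X (Function.update x' j (x j)) (Function.update y' j (y j)) = X x' y' := by
      have e1 := hxy j (by simp)
      have e2 := hxy' j (by simp)
      by_cases hc : x j = x' j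
      · rw [← e1, hc, Function.update_eq_self, e2, Function.update_eq_self]
      · have e3 : x j = 1 - x' j := by omega
        have := (h j (by simp)).flip x' y'
        rw [← this, flipAt, flipAt, ← e2, ← e3, ← e1]
    rw [← step]
    apply ih (fun i hi => h i (by simp [hi])) (fun i hi => hxy i (by simp [hi]))
    · intro i hi
      have : i ≠ j := fun e => hj (e ▸ hi)
      simpa [this] using hxy' i (by simp [hi])
    · intro i hi
      by_cases hij : i = j
      · subst hij; simp
      · simpa [hij] using hx i (by simp [hij, hi])
    · intro i hi
      by_cases hij : i = j
      · subst hij; simp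
      · simpa [hij] using hy i (by simp [hij, hi])

omit [Fintype Λ] in
theorem apply_eq_zero {S : Finset Λ} (h : ∀ i ∈ S, TrivialAt i X) {x y : Λ → Fin 2}
    (hxy : ¬ ∀ i ∈ S, x i = y i) : X x y = 0 := by
  push Not at hxy
  obtain ⟨i, hi, hne⟩ := hxy
  exact (h i hi).eq_zero x y hne

/-- Disjoint supports. In an entry of either product a single intermediate label survives, the
hybrid of `x` and `z`, so both products reduce to the same product of two entries. -/
theorem commute {S : Finset Λ} (hX : ∀ i ∈ S, TrivialAt i X) (hY : ∀ i ∉ S, TrivialAt i Y) :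
    X * Y = Y * X := by
  have hY' : ∀ i ∈ Sᶜ, TrivialAt i Y := fun i hi => hY i (Finset.mem_compl.1 hi)
  ext x z
  rw [Matrix.mul_apply, Matrix.mul_apply]
  rw [Finset.sum_eq_single (fun i => if i ∈ S then x i else z i),
    Finset.sum_eq_single (fun i => if i ∈ S then z i else x i), mul_comm]
  · congr 1
    · apply apply_eq_of_agree hY'
      all_goals simp +contextual
    · apply apply_eq_of_agree hX
      all_goals simp +contextual
  · intro y _ hy
    by_cases h1 : ∀ i ∈ Sᶜ, x i = y i
    · rw [apply_eq_zero hX (x := y), mul_zero]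
      intro h2
      refine hy (funext fun i => ?_)
      by_cases hi : i ∈ S
      · simp [hi, h2 i hi]
      · simp [hi, h1 i (by simpa using hi)]
    · rw [apply_eq_zero hY' h1, zero_mul]
  · simp
  · intro y _ hy
    by_cases h1 : ∀ i ∈ S, x i = y i
    · rw [apply_eq_zero hY' (x := y), mul_zero]
      intro h2
      refine hy (funext fun i => ?_)
      by_cases hi : i ∈ S
      · simp [hi, h1 i hi]
      · simp [hi, h2 i (by simpa using hi)]
    · rw [apply_eq_zero hX h1, zero_mul]
  · simp

theorem map_krausMap {ι : Type*} [Fintype ι] {K : ι → Matrix (Λ → Fin 2) (Λ → Fin 2) ℂ}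
    (hK : ∀ k, TrivialAt i (K k)) (hX : TrivialAt i X) :
    TrivialAt i (krausMap K X) := by
  rw [krausMap_apply]
  exact sum fun k _ => (hK k).star.mul (hX.mul (hK k))

end TrivialAt

theorem supportedOn_of_trivialAt {Y : Finset Λ} {V : Matrix (Λ → Fin 2) (Λ → Fin 2) ℂ}
    (h : ∀ i ∉ Y, TrivialAt i V) : SupportedOn Y V := by
  have h' : ∀ i ∈ Yᶜ, TrivialAt i V := fun i hi => h i (Finset.mem_compl.1 hi)
  refine ⟨Matrix.of fun α β => V (fun i => if hi : i ∈ Y then α ⟨i, hi⟩ else 0)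
    (fun i => if hi : i ∈ Y then β ⟨i, hi⟩ else 0), fun x y => ?_⟩
  split_ifs with hxy
  · have hxy' : ∀ i ∈ Yᶜ, x i = y i := fun i hi => congrFun hxy ⟨i, hi⟩
    refine TrivialAt.apply_eq_of_agree h' ?_ hxy' ?_ ?_ <;>
      simp +contextual [restrictCfg]
  · apply TrivialAt.apply_eq_zero h'
    intro h2
    exact hxy (funext fun i => h2 i i.2)

end TrivialAt

/-! ### Cleaning maps -/

section Cleanable

variable {Λ : Type} [Fintype Λ] [DecidableEq Λ]

/-- There is a unital Schwarz map, local to `N`, that makes every operator trivial on `A` and that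
preserves, up to `ε` and on the code with projector `P`, the operators that are trivial on `B`. -/
def Cleanable (P : Matrix (Λ → Fin 2) (Λ → Fin 2) ℂ) (A N B : Finset Λ) (ε : ℝ) : Prop :=
  ∃ T : Matrix (Λ → Fin 2) (Λ → Fin 2) ℂ →ₗ[ℂ] Matrix (Λ → Fin 2) (Λ → Fin 2) ℂ,
    IsUnitalSchwarz T ∧ (∀ X, ∀ i ∈ A, TrivialAt i (T X)) ∧
      (∀ X, ∀ i ∉ N, TrivialAt i X → TrivialAt i (T X)) ∧
        ∀ X, (∀ i ∈ B, TrivialAt i X) → ‖P * (T X - X) * P‖ ≤ ε * ‖X‖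

namespace Cleanable

variable {P : Matrix (Λ → Fin 2) (Λ → Fin 2) ℂ}

theorem mono {A N N' B B' : Finset Λ} {ε ε' : ℝ} (h : Cleanable P A N B ε) (hN : N ⊆ N')
    (hB : B ⊆ B') (hε : ε ≤ ε') : Cleanable P A N' B' ε' := by
  obtain ⟨T, h1, h2, h3, h4⟩ := h
  refine ⟨T, h1, h2, fun X i hi => h3 X i (fun h => hi (hN h)), fun X hX => ?_⟩
  exact (h4 X fun i hi => hX i (hB hi)).trans (by gcongr)

/-- The map is `T₁ ∘ T₂`. By `hA`, the map `T₁` leaves alone what `T₂` cleaned outside `A₁`. By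
`hB₁`, every site of `B₁` has been cleaned by `T₂` or was trivial before and is out of its reach, so
`T₂ X` meets the requirement of `T₁`. -/
theorem union {A₁ A₂ N₁ N₂ B₁ B₂ B : Finset Λ} {ε₁ ε₂ : ℝ} (hε : 0 ≤ ε₁)
    (h₁ : Cleanable P A₁ N₁ B₁ ε₁) (h₂ : Cleanable P A₂ N₂ B₂ ε₂) (hA : A₂ ∩ N₁ ⊆ A₁)
    (hB₂ : B₂ ⊆ B) (hB₁ : B₁ ⊆ A₂ ∪ (B \ N₂)) :
    Cleanable P (A₁ ∪ A₂) (N₁ ∪ N₂) B (ε₁ + ε₂) := by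
  obtain ⟨T₁, h11, h12, h13, h14⟩ := h₁
  obtain ⟨T₂, h21, h22, h23, h24⟩ := h₂
  refine ⟨T₁ ∘ₗ T₂, h11.comp h21, fun X i hi => ?_, fun X i hi h => ?_, fun X hX => ?_⟩
  · by_cases hi1 : i ∈ A₁
    · exact h12 _ i hi1
    · have hi2 : i ∈ A₂ := by simpa [hi1] using hi
      exact h13 _ i (fun hN => hi1 (hA (Finset.mem_inter.2 ⟨hi2, hN⟩))) (h22 X i hi2)
  · rw [Finset.mem_union, not_or] at hi
    exact h13 _ i hi.1 (h23 X i hi.2 h)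
  · have e1 : ‖P * (T₁ (T₂ X) - T₂ X) * P‖ ≤ ε₁ * ‖X‖ := by
      refine (h14 (T₂ X) fun i hi => ?_).trans
        (mul_le_mul_of_nonneg_left (h21.norm_map_le X) hε)
      rcases Finset.mem_union.1 (hB₁ hi) with h | h
      · exact h22 X i h
      · rw [Finset.mem_sdiff] at h
        exact h23 X i h.2 (hX i h.1)
    have e2 : ‖P * (T₂ X - X) * P‖ ≤ ε₂ * ‖X‖ := h24 X fun i hi => hX i (hB₂ hi)
    have e3 : P * ((T₁ ∘ₗ T₂) X - X) * P =
        P * (T₁ (T₂ X) - T₂ X) * P + P * (T₂ X - X) * P := by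
      simp only [LinearMap.comp_apply]
      noncomm_ring
    rw [e3, add_mul]
    exact (norm_add_le _ _).trans (add_le_add e1 e2)

theorem empty : Cleanable P ∅ ∅ ∅ 0 :=
  ⟨LinearMap.id, IsUnitalSchwarz.id, by simp, by simp, by simp⟩

/-- Logical operators can be cleaned out of a cleanable region. -/
theorem exists_supportedOn (hP : IsStarProjection P) {A N Y : Finset Λ} {ε : ℝ} (hε : 0 ≤ ε)
    (h : Cleanable P A N ∅ ε) (hY : ∀ i ∉ Y, i ∈ A) {U : Matrix (Λ → Fin 2) (Λ → Fin 2) ℂ}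
    (hU : IsLogical P U) (hU1 : ‖U‖ ≤ 1) :
    ∃ V, SupportedOn Y V ∧ ‖(U - V) * P‖ ≤ Real.sqrt (3 * ε) := by
  obtain ⟨T, h1, h2, -, h4⟩ := h
  exact ⟨T U, supportedOn_of_trivialAt fun i hi => h2 U i (hY i hi),
    h1.norm_sub_mul_le hP hε (fun X => h4 X (by simp)) hU hU1⟩

end Cleanable

end Cleanable

/-! ### Approximate factorization of an isometry -/

section Factor

variable {H F G : Type*} [NormedAddCommGroup H] [InnerProductSpace ℂ H]
  [NormedAddCommGroup F] [InnerProductSpace ℂ F] [NormedAddCommGroup G] [InnerProductSpace ℂ G]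

theorem norm_tensor {τ : F →ₗ[ℂ] H →ₗ[ℂ] G}
    (hτ : ∀ φ φ' ψ ψ', inner ℂ (τ φ ψ) (τ φ' ψ') = inner ℂ φ φ' * inner ℂ ψ ψ') (φ : F) (ψ : H) :
    ‖τ φ ψ‖ = ‖φ‖ * ‖ψ‖ := by
  have h := hτ φ φ ψ ψ
  simp only [inner_self_eq_norm_sq_to_K] at h
  have h2 : ‖τ φ ψ‖ ^ 2 = (‖φ‖ * ‖ψ‖) ^ 2 := by
    rw [mul_pow]; exact_mod_cast h
  exact (pow_left_inj₀ (norm_nonneg _) (by positivity) two_ne_zero).1 h2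

/-- If a linear map sends every vector `ψ` of a subspace close to some product vector `φ ⊗ ψ`,
then `φ` can be chosen independently of `ψ`. -/
theorem exists_uniform_factor [Nontrivial F] (τ : F →ₗ[ℂ] H →ₗ[ℂ] G)
    (hτ : ∀ φ φ' ψ ψ', inner ℂ (τ φ ψ) (τ φ' ψ') = inner ℂ φ φ' * inner ℂ ψ ψ')
    (W : H →ₗ[ℂ] G) (C : Submodule ℂ H) {s : ℝ} (hs : 0 ≤ s)
    (h : ∀ ψ ∈ C, ‖ψ‖ = 1 → ∃ φ : F, ‖φ‖ = 1 ∧ ‖W ψ - τ φ ψ‖ ≤ s) :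
    ∃ φ : F, ‖φ‖ = 1 ∧ ∀ ψ ∈ C, ‖W ψ - τ φ ψ‖ ≤ 7 * s * ‖ψ‖ := by
  have hscale : ∀ ψ ∈ C, ∃ φ : F, ‖φ‖ = 1 ∧ ‖W ψ - τ φ ψ‖ ≤ s * ‖ψ‖ := by
    intro ψ hψ
    by_cases h0 : ψ = 0
    · obtain ⟨φ, hφ⟩ := exists_norm_eq F zero_le_one
      exact ⟨φ, hφ, by simp [h0]⟩
    · have hn : (0 : ℝ) < ‖ψ‖ := norm_pos_iff.2 h0
      obtain ⟨φ, hφ, hb⟩ := h ((‖ψ‖⁻¹ : ℂ) • ψ) (C.smul_mem _ hψ)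
        (by rw [norm_smul, norm_inv, Complex.norm_real, norm_norm, inv_mul_cancel₀ hn.ne'])
      refine ⟨φ, hφ, ?_⟩
      rw [map_smul, map_smul, ← smul_sub, norm_smul, norm_inv, Complex.norm_real, norm_norm,
        inv_mul_le_iff₀ hn] at hb
      linarith
  by_cases hC : ∃ ψ ∈ C, ψ ≠ 0
  swap
  · push Not at hC
    obtain ⟨φ, hφ⟩ := exists_norm_eq F zero_le_one
    exact ⟨φ, hφ, fun ψ hψ => by simp [hC ψ hψ]⟩
  obtain ⟨ψ', hψ', hne⟩ := hC
  obtain ⟨ψ₀, hψ₀, hψ₀n⟩ : ∃ ψ₀ ∈ C, ‖ψ₀‖ = 1 :=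
    ⟨(‖ψ'‖⁻¹ : ℂ) • ψ', C.smul_mem _ hψ', by
      rw [norm_smul, norm_inv, Complex.norm_real, norm_norm,
        inv_mul_cancel₀ (norm_pos_iff.2 hne).ne']⟩
  obtain ⟨φ₀, hφ₀, hb₀⟩ := hscale ψ₀ hψ₀
  rw [hψ₀n, mul_one] at hb₀
  refine ⟨φ₀, hφ₀, fun ψ hψ => ?_⟩
  -- unit vectors orthogonal to `ψ₀`
  have horth : ∀ ψ₁ ∈ C, ‖ψ₁‖ = 1 → inner ℂ ψ₀ ψ₁ = 0 → ‖W ψ₁ - τ φ₀ ψ₁‖ ≤ 6 * s := by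
    intro ψ₁ hψ₁ hψ₁n ho
    obtain ⟨φ₁, -, hb₁⟩ := hscale ψ₁ hψ₁
    obtain ⟨φ₂, -, hb₂⟩ := hscale (ψ₀ + ψ₁) (C.add_mem hψ₀ hψ₁)
    rw [hψ₁n, mul_one] at hb₁
    have hn2 : ‖ψ₀ + ψ₁‖ ^ 2 = 2 := by
      rw [@norm_add_sq ℂ, ho, hψ₀n, hψ₁n]; norm_num
    have hn3 : ‖ψ₀ + ψ₁‖ ≤ 1.42 := by
      nlinarith [norm_nonneg (ψ₀ + ψ₁)]
    have e1 : τ (φ₀ - φ₂) ψ₀ + τ (φ₁ - φ₂) ψ₁ =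
        (W (ψ₀ + ψ₁) - τ φ₂ (ψ₀ + ψ₁)) - (W ψ₀ - τ φ₀ ψ₀) - (W ψ₁ - τ φ₁ ψ₁) := by
      simp only [map_sub, map_add, LinearMap.sub_apply]
      abel
    have e2 : ‖τ (φ₀ - φ₂) ψ₀ + τ (φ₁ - φ₂) ψ₁‖ ≤ 3.42 * s := by
      rw [e1]
      have i1 := norm_sub_le ((W (ψ₀ + ψ₁) - τ φ₂ (ψ₀ + ψ₁)) - (W ψ₀ - τ φ₀ ψ₀)) (W ψ₁ - τ φ₁ ψ₁)
      have i2 := norm_sub_le (W (ψ₀ + ψ₁) - τ φ₂ (ψ₀ + ψ₁)) (W ψ₀ - τ φ₀ ψ₀)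
      nlinarith
    have e3 : ‖τ (φ₀ - φ₂) ψ₀ + τ (φ₁ - φ₂) ψ₁‖ ^ 2 = ‖φ₀ - φ₂‖ ^ 2 + ‖φ₁ - φ₂‖ ^ 2 := by
      rw [@norm_add_sq ℂ, hτ, ho, norm_tensor hτ, norm_tensor hτ, hψ₀n, hψ₁n]
      simp
    have e4 : ‖φ₁ - φ₀‖ ≤ ‖φ₁ - φ₂‖ + ‖φ₀ - φ₂‖ := by
      rw [norm_sub_rev φ₀ φ₂]; exact norm_sub_le_norm_sub_add_norm_sub _ _ _
    -- From `(a + b)² ≤ 2 (a² + b²)` and `2 · 3.42² < 25`.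
    have e5 : ‖φ₁ - φ₀‖ ≤ 5 * s := by
      refine e4.trans (abs_le_of_sq_le_sq' ?_ (by positivity)).2
      have := pow_le_pow_left₀ (norm_nonneg _) e2 2
      rw [e3] at this
      nlinarith [sq_nonneg (‖φ₁ - φ₂‖ - ‖φ₀ - φ₂‖), sq_nonneg s]
    have e6 : W ψ₁ - τ φ₀ ψ₁ = (W ψ₁ - τ φ₁ ψ₁) + τ (φ₁ - φ₀) ψ₁ := by
      simp only [map_sub, LinearMap.sub_apply]; abel
    rw [e6]
    refine (norm_add_le _ _).trans ?_
    rw [norm_tensor hτ, hψ₁n]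
    linarith
  set a : ℂ := inner ℂ ψ₀ ψ with ha
  set χ : H := ψ - a • ψ₀ with hχ
  have hχC : χ ∈ C := C.sub_mem hψ (C.smul_mem _ hψ₀)
  have hχo : inner ℂ ψ₀ χ = 0 := by
    rw [hχ, inner_sub_right, inner_smul_right, inner_self_eq_norm_sq_to_K, hψ₀n]
    simp [ha]
  have hsum : ‖ψ‖ ^ 2 = ‖a‖ ^ 2 + ‖χ‖ ^ 2 := by
    have : ψ = a • ψ₀ + χ := by simp [hχ]
    conv_lhs => rw [this]
    rw [@norm_add_sq ℂ, inner_smul_left, hχo, norm_smul, hψ₀n]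
    simp
  have hχb : ‖W χ - τ φ₀ χ‖ ≤ 6 * s * ‖χ‖ := by
    by_cases h0 : χ = 0
    · simp [h0]
    have hn : (0 : ℝ) < ‖χ‖ := norm_pos_iff.2 h0
    have := horth ((‖χ‖⁻¹ : ℂ) • χ) (C.smul_mem _ hχC)
      (by rw [norm_smul, norm_inv, Complex.norm_real, norm_norm, inv_mul_cancel₀ hn.ne'])
      (by rw [inner_smul_right, hχo, mul_zero])
    rw [map_smul, map_smul, ← smul_sub, norm_smul, norm_inv, Complex.norm_real, norm_norm,
      inv_mul_le_iff₀ hn] at this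
    linarith
  have hfin : W ψ - τ φ₀ ψ = a • (W ψ₀ - τ φ₀ ψ₀) + (W χ - τ φ₀ χ) := by
    simp only [hχ, map_sub, map_smul, smul_sub]; abel
  have hl1 : ‖a‖ ≤ ‖ψ‖ := (sq_le_sq₀ (norm_nonneg _) (norm_nonneg _)).1 (by nlinarith [sq_nonneg ‖χ‖])
  have hl2 : ‖χ‖ ≤ ‖ψ‖ := (sq_le_sq₀ (norm_nonneg _) (norm_nonneg _)).1 (by nlinarith [sq_nonneg ‖a‖])
  rw [hfin]
  refine (norm_add_le _ _).trans ?_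
  rw [norm_smul]
  have := mul_le_mul hl1 hb₀ (norm_nonneg _) (norm_nonneg _)
  nlinarith

end Factor

/-! ### Stinespring isometries and Kraus families that are nearly scalar on the code. -/

section Stack

variable {n ι : Type*} [Fintype n] [DecidableEq n] [Fintype ι] [DecidableEq ι]

/-- The operators of a family as the blocks of one column. -/
def stack (K : ι → Matrix n n ℂ) : Matrix (ι × n) n ℂ := Matrix.of fun p y => K p.1 p.2 y

open scoped Kronecker in
/-- The ampliation `1 ⊗ X`. -/
def ampl (ι : Type*) [Fintype ι] [DecidableEq ι] (X : Matrix n n ℂ) : Matrix (ι × n) (ι × n) ℂ :=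
  (1 : Matrix ι ι ℂ) ⊗ₖ X

open scoped Kronecker in
theorem norm_ampl_le (X : Matrix n n ℂ) : ‖ampl ι X‖ ≤ ‖X‖ := by
  let f : Matrix n n ℂ →⋆ₙₐ[ℂ] Matrix (ι × n) (ι × n) ℂ :=
    { toFun := fun X => (1 : Matrix ι ι ℂ) ⊗ₖ X
      map_smul' := fun c X => by simp [Matrix.kronecker_smul]
      map_zero' := by simp
      map_add' := fun X Y => by simp [Matrix.kronecker_add]
      map_mul' := fun X Y => by rw [← Matrix.mul_kronecker_mul, one_mul]
      map_star' := fun X => by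
        simp only [Matrix.star_eq_conjTranspose, Matrix.conjTranspose_kronecker,
          Matrix.conjTranspose_one] }
  exact NonUnitalStarAlgHom.norm_apply_le f X

omit [Fintype ι] [DecidableEq n] in
theorem ampl_mul_stack [Fintype ι] (K : ι → Matrix n n ℂ) (X : Matrix n n ℂ) :
    ampl ι X * stack K = stack fun i => X * K i := by
  ext ⟨i, x⟩ y
  simp [ampl, stack, Matrix.mul_apply, Fintype.sum_prod_type, Matrix.one_apply, ite_mul]

omit [Fintype ι] [DecidableEq n] [DecidableEq ι] in
theorem stack_mul (K : ι → Matrix n n ℂ) (X : Matrix n n ℂ) :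
    stack K * X = stack fun i => K i * X := rfl

omit [DecidableEq n] [DecidableEq ι] in
theorem stack_conjTranspose_mul (K L : ι → Matrix n n ℂ) :
    (stack K).conjTranspose * stack L = ∑ i, star (K i) * L i := by
  ext x y
  simp [stack, Matrix.mul_apply, Fintype.sum_prod_type, Matrix.sum_apply]

omit [DecidableEq n] in
theorem krausMap_eq_stack (K : ι → Matrix n n ℂ) (X : Matrix n n ℂ) :
    krausMap K X = (stack K).conjTranspose * (ampl ι X * stack K) := by
  rw [ampl_mul_stack, stack_conjTranspose_mul, krausMap_apply]

omit [DecidableEq ι] in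
theorem norm_stack_le_one {K : ι → Matrix n n ℂ} (hK : ∑ i, star (K i) * K i = 1) :
    ‖stack K‖ ≤ 1 := by
  have h := Matrix.l2_opNorm_conjTranspose_mul_self (stack K)
  rw [stack_conjTranspose_mul, hK] at h
  have : ‖(1 : Matrix n n ℂ)‖ ≤ 1 := by
    rcases subsingleton_or_nontrivial (Matrix n n ℂ) with hs | hs
    · simp [Subsingleton.elim (1 : Matrix n n ℂ) 0]
    · simp
  nlinarith [norm_nonneg (stack K)]

/-- With the isometries `V = stack K` and `W = stack L`, telescope `V* (1 ⊗ X) V - W* (1 ⊗ X) W`;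
each of the two terms contains one factor `(V - W) P` or its adjoint. -/
theorem norm_krausMap_sub_le {K L : ι → Matrix n n ℂ} (hK : ∑ i, star (K i) * K i = 1)
    (hL : ∑ i, star (L i) * L i = 1) {P : Matrix n n ℂ} (hP : IsStarProjection P) {η : ℝ}
    (h : ‖(stack K - stack L) * P‖ ≤ η) (X : Matrix n n ℂ) :
    ‖P * (krausMap K X - krausMap L X) * P‖ ≤ 2 * η * ‖X‖ := by
  have hPs : P.conjTranspose = P := hP.isSelfAdjoint
  have hP1 : ‖P‖ ≤ 1 := hP.norm_le
  have e : P * (krausMap K X - krausMap L X) * P =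
      (P * (stack K).conjTranspose) * (ampl ι X * ((stack K - stack L) * P)) +
        ((stack K - stack L) * P).conjTranspose * (ampl ι X * (stack L * P)) := by
    rw [krausMap_eq_stack, krausMap_eq_stack, Matrix.conjTranspose_mul, hPs,
      Matrix.conjTranspose_sub]
    simp only [Matrix.mul_sub, Matrix.sub_mul, Matrix.mul_assoc]
    abel
  have hη : 0 ≤ η := (norm_nonneg _).trans h
  have hX := norm_ampl_le (ι := ι) X
  have a1 : ‖P * (stack K).conjTranspose‖ ≤ 1 := by
    refine (Matrix.l2_opNorm_mul _ _).trans ?_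
    rw [Matrix.l2_opNorm_conjTranspose]
    exact mul_le_one₀ hP1 (norm_nonneg _) (norm_stack_le_one hK)
  have a2 : ‖stack L * P‖ ≤ 1 :=
    (Matrix.l2_opNorm_mul _ _).trans (mul_le_one₀ (norm_stack_le_one hL) (norm_nonneg _) hP1)
  have a3 : ‖ampl ι X * ((stack K - stack L) * P)‖ ≤ ‖X‖ * η :=
    (Matrix.l2_opNorm_mul _ _).trans (mul_le_mul hX h (norm_nonneg _) (norm_nonneg _))
  have a4 : ‖ampl ι X * (stack L * P)‖ ≤ ‖X‖ * 1 :=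
    (Matrix.l2_opNorm_mul _ _).trans (mul_le_mul hX a2 (norm_nonneg _) (norm_nonneg _))
  have b1 : ‖(P * (stack K).conjTranspose) * (ampl ι X * ((stack K - stack L) * P))‖ ≤
      1 * (‖X‖ * η) :=
    (Matrix.l2_opNorm_mul _ _).trans (mul_le_mul a1 a3 (norm_nonneg _) zero_le_one)
  have b2 : ‖((stack K - stack L) * P).conjTranspose * (ampl ι X * (stack L * P))‖ ≤
      η * (‖X‖ * 1) := by
    refine (Matrix.l2_opNorm_mul _ _).trans ?_
    rw [Matrix.l2_opNorm_conjTranspose]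
    exact mul_le_mul h a4 (norm_nonneg _) hη
  rw [e]
  refine (norm_add_le _ _).trans ?_
  linarith

omit [DecidableEq ι] in
/-- If the operation with Kraus operators `K` has fidelity close to one on every
code state, then `K` acts on the code approximately as a vector of scalars. -/
theorem exists_scalar_kraus [Nonempty n] {K : ι → Matrix n n ℂ}
    (hK : ∑ i, star (K i) * K i = 1) {P : Matrix n n ℂ} (hP : IsStarProjection P) {δ : ℝ}
    (hδ : 0 ≤ δ)
    (h : ∀ ψ : n → ℂ, P.mulVec ψ = ψ → star ψ ⬝ᵥ ψ = 1 →
      1 - δ ^ 2 ≤ Real.sqrt (∑ i, ‖star ψ ⬝ᵥ (K i).mulVec ψ‖ ^ 2)) :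
    ∃ φ : ι → ℂ, ∑ i, star (φ i) * φ i = 1 ∧
      ‖(stack K - stack fun i => φ i • (1 : Matrix n n ℂ)) * P‖ ≤ 10 * δ := by
  have hι : Nonempty ι := by
    by_contra hne
    rw [not_nonempty_iff] at hne
    simp at hK
  let τ : EuclideanSpace ℂ ι →ₗ[ℂ] EuclideanSpace ℂ n →ₗ[ℂ] EuclideanSpace ℂ (ι × n) :=
    LinearMap.mk₂ ℂ (fun φ ψ => WithLp.toLp 2 fun p => φ p.1 * ψ p.2)
      (fun _ _ _ => by ext; simp [add_mul]) (fun _ _ _ => by ext; simp [mul_assoc])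
      (fun _ _ _ => by ext; simp [mul_add]) (fun _ _ _ => by ext; simp [mul_left_comm])
  have hτ : ∀ φ φ' ψ ψ', inner ℂ (τ φ ψ) (τ φ' ψ') = inner ℂ φ φ' * inner ℂ ψ ψ' := by
    intro φ φ' ψ ψ'
    simp only [PiLp.inner_apply, τ, LinearMap.mk₂_apply, Fintype.sum_prod_type,
      Finset.sum_mul_sum]
    refine Finset.sum_congr rfl fun i _ => Finset.sum_congr rfl fun x _ => ?_
    simp; ring
  let W : EuclideanSpace ℂ n →ₗ[ℂ] EuclideanSpace ℂ (ι × n) := Matrix.toEuclideanLin (stack K)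
  have hWinner : ∀ φ ψ, inner ℂ (τ φ ψ) (W ψ) =
      inner ℂ φ (WithLp.toLp 2 fun i => star (WithLp.ofLp ψ) ⬝ᵥ (K i).mulVec (WithLp.ofLp ψ)) := by
    intro φ ψ
    simp only [PiLp.inner_apply, τ, LinearMap.mk₂_apply, Fintype.sum_prod_type, W,
      Matrix.toLpLin_apply, stack, Matrix.mulVec, dotProduct, Matrix.of_apply]
    refine Finset.sum_congr rfl fun i _ => ?_
    simp only [RCLike.inner_apply, map_mul, Pi.star_apply, RCLike.star_def]
    rw [Finset.sum_mul]
    exact Finset.sum_congr rfl fun x _ => by ring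
  have hWnorm : ∀ ψ, ‖W ψ‖ = ‖ψ‖ := by
    intro ψ
    have e : inner ℂ (W ψ) (W ψ) = inner ℂ ψ ψ := by
      rw [EuclideanSpace.inner_eq_star_dotProduct, EuclideanSpace.inner_eq_star_dotProduct,
        dotProduct_comm, dotProduct_comm (WithLp.ofLp ψ)]
      simp only [W, Matrix.toLpLin_apply]
      rw [Matrix.star_mulVec, Matrix.dotProduct_mulVec, Matrix.vecMul_vecMul,
        stack_conjTranspose_mul, hK, Matrix.vecMul_one]
    rw [inner_self_eq_norm_sq_to_K, inner_self_eq_norm_sq_to_K] at e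
    exact (pow_left_inj₀ (norm_nonneg _) (norm_nonneg _) two_ne_zero).1 (by exact_mod_cast e)
  let C : Submodule ℂ (EuclideanSpace ℂ n) :=
    LinearMap.ker (Matrix.toEuclideanLin P - LinearMap.id)
  have hCmem : ∀ ψ, ψ ∈ C ↔ P.mulVec (WithLp.ofLp ψ) = WithLp.ofLp ψ := by
    intro ψ
    simp only [C, LinearMap.mem_ker, LinearMap.sub_apply, LinearMap.id_apply, sub_eq_zero,
      Matrix.toLpLin_apply, WithLp.ext_iff]
  -- For a unit code vector, `φ` is the normalized vector `c` of expectations `⟨ψ, Kᵢ ψ⟩`. Then `‖Wψ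
  -- - φ ⊗ ψ‖² = 2 - 2‖c‖ ≤ 2δ²`, which gives `s = √2 δ`; the final constant comes from `7√2 ≤ 10`.
  obtain ⟨φ, hφ, hb⟩ := exists_uniform_factor τ hτ W C (s := Real.sqrt 2 * δ) (by positivity) (by
    intro ψ hψ hψ1
    set c : EuclideanSpace ℂ ι :=
      WithLp.toLp 2 fun i => star (WithLp.ofLp ψ) ⬝ᵥ (K i).mulVec (WithLp.ofLp ψ) with hc
    have hcn : 1 - δ ^ 2 ≤ ‖c‖ := by
      rw [EuclideanSpace.norm_eq]
      refine h _ ((hCmem ψ).1 hψ) ?_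
      have := @inner_self_eq_norm_sq_to_K ℂ _ _ _ _ ψ
      rw [hψ1, EuclideanSpace.inner_eq_star_dotProduct, dotProduct_comm] at this
      simpa using this
    obtain ⟨φ, hφ, hφc⟩ : ∃ φ : EuclideanSpace ℂ ι, ‖φ‖ = 1 ∧ inner ℂ φ c = (‖c‖ : ℂ) := by
      by_cases h0 : c = 0
      · obtain ⟨φ, hφ⟩ := exists_norm_eq (EuclideanSpace ℂ ι) zero_le_one
        exact ⟨φ, hφ, by simp [h0]⟩
      · have hn : (0 : ℝ) < ‖c‖ := norm_pos_iff.2 h0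
        refine ⟨(‖c‖⁻¹ : ℂ) • c, ?_, ?_⟩
        · rw [norm_smul, norm_inv, Complex.norm_real, norm_norm, inv_mul_cancel₀ hn.ne']
        · rw [inner_smul_left, inner_self_eq_norm_sq_to_K]
          have : (‖c‖ : ℂ) ≠ 0 := by exact_mod_cast hn.ne'
          simp
          field_simp
    refine ⟨φ, hφ, ?_⟩
    refine (abs_le_of_sq_le_sq' ?_ (by positivity)).2
    rw [@norm_sub_sq ℂ, hWnorm, norm_tensor hτ, hψ1, hφ, ← inner_conj_symm, hWinner, hφc,
      mul_pow (Real.sqrt 2), Real.sq_sqrt zero_le_two]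
    simp
    linarith)
  refine ⟨WithLp.ofLp φ, ?_, ?_⟩
  · have := @inner_self_eq_norm_sq_to_K ℂ _ _ _ _ φ
    rw [hφ, EuclideanSpace.inner_eq_star_dotProduct, dotProduct_comm] at this
    simpa [dotProduct] using this
  · rw [Matrix.l2_opNorm_def]
    refine ContinuousLinearMap.opNorm_le_bound _ (by positivity) fun v => ?_
    have hPP : P * P = P := hP.isIdempotentElem
    set u : EuclideanSpace ℂ n := WithLp.toLp 2 (P.mulVec (WithLp.ofLp v)) with hu
    have huC : u ∈ C := (hCmem u).2 (by simp [hu, hPP])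
    have hun : ‖u‖ ≤ ‖v‖ := by
      have := (Matrix.l2_opNorm_mulVec P v).trans
        (mul_le_mul_of_nonneg_right hP.norm_le (norm_nonneg v))
      simpa [hu] using this
    have e : W u - τ φ u = Matrix.toEuclideanLin
        ((stack K - stack fun i => WithLp.ofLp φ i • (1 : Matrix n n ℂ)) * P) v := by
      rw [Matrix.sub_mul, map_sub, LinearMap.sub_apply]
      congr 1
      · simp [W, hu, Matrix.toLpLin_apply]
      · rw [stack_mul]
        ext p
        simp [τ, hu, Matrix.toLpLin_apply, stack, Matrix.mulVec, dotProduct,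
          Finset.mul_sum, mul_assoc]
    have h7 := hb u huC
    have hsq : Real.sqrt 2 ≤ 1.42 := Real.sqrt_le_iff.2 (by norm_num)
    rw [e] at h7
    refine h7.trans ?_
    have : 7 * (Real.sqrt 2 * δ) ≤ 10 * δ := by nlinarith
    exact mul_le_mul this hun (norm_nonneg _) (by positivity)

end Stack

/-! ### Kraus operators of a channel -/

section Kraus

open scoped ComplexOrder MatrixOrder

variable {ι ι' : Type} [Fintype ι] [DecidableEq ι] [Fintype ι'] [DecidableEq ι']

theorem IsChannel.exists_kraus {Φ : Matrix ι ι ℂ →ₗ[ℂ] Matrix ι' ι' ℂ} (h : IsChannel Φ) :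
    ∃ (m : ℕ) (R : Fin m → Matrix ι' ι ℂ),
      (∀ X, Φ X = ∑ e, R e * X * (R e).conjTranspose) ∧
        ∑ e, (R e).conjTranspose * R e = 1 := by
  -- Choi's argument: `ω` is an unnormalized maximally entangled vector, the image of its projector
  -- is positive, and the rows of a factor `B` of `B* B` are the Kraus operators up to conjugation.
  let e := Fintype.equivFin ι
  let ω : ι × Fin (Fintype.card ι) → ℂ := fun p => if e p.1 = p.2 then 1 else 0
  have hC := h.completelyPositive _ _ (Matrix.posSemidef_vecMulVec_self_star ω)
  obtain ⟨B, hB⟩ := CStarAlgebra.nonneg_iff_eq_star_mul_self.mp hC.nonneg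
  let f := Fintype.equivFin (ι' × Fin (Fintype.card ι))
  let R : Fin (Fintype.card (ι' × Fin (Fintype.card ι))) → Matrix ι' ι ℂ :=
    fun k => Matrix.of fun p i => star (B (f.symm k) (p, e i))
  have hR : ∀ X, Φ X = ∑ k, R k * X * (R k).conjTranspose := by
    let Ψ : Matrix ι ι ℂ →ₗ[ℂ] Matrix ι' ι' ℂ :=
      { toFun := fun X => ∑ k, R k * X * (R k).conjTranspose
        map_add' := fun X Y => by
          simp only [Matrix.mul_add, Matrix.add_mul, Finset.sum_add_distrib]
        map_smul' := fun c X => by simp [Finset.smul_sum] }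
    suffices hΨ : Φ = Ψ from fun X => LinearMap.congr_fun hΨ X
    refine Matrix.ext_linearMap _ fun i j => LinearMap.ext_ring ?_
    ext p q
    have h1 := congrFun (congrFun hB (p, e i)) (q, e j)
    have h2 : (Matrix.of fun i' j' => Matrix.vecMulVec ω (star ω) (i', e i) (j', e j)) =
        Matrix.single i j (1 : ℂ) := by
      ext i' j'
      by_cases hi : i = i' <;> by_cases hj : j = j' <;>
        simp [ω, Matrix.vecMulVec_apply, hi, hj, eq_comm]
    simp only [ampliation, Matrix.of_apply] at h1
    rw [h2] at h1
    simp only [LinearMap.comp_apply, Matrix.singleLinearMap_apply]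
    rw [h1]
    simp only [Ψ, LinearMap.coe_mk, AddHom.coe_mk, Matrix.sum_apply]
    rw [Matrix.mul_apply, ← f.symm.sum_comp]
    refine Finset.sum_congr rfl fun k _ => ?_
    simp [R, Matrix.mul_apply, Matrix.single_apply, Matrix.star_apply, ite_and,
      Finset.sum_ite_eq]
  refine ⟨_, R, hR, ?_⟩
  have h3 : ∀ X : Matrix ι ι ℂ, ((∑ k, (R k).conjTranspose * R k) * X).trace = (1 * X).trace := by
    intro X
    rw [one_mul, ← h.tracePreserving X, hR X, Finset.sum_mul, Matrix.trace_sum, Matrix.trace_sum]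
    refine Finset.sum_congr rfl fun k _ => ?_
    rw [Matrix.mul_assoc, Matrix.trace_mul_comm]
  exact Matrix.ext_iff_trace_mul_right.2 h3

end Kraus

/-! ### Fidelity with a pure state. -/

section Fidelity

open scoped ComplexOrder MatrixOrder

variable {ι : Type} [Fintype ι] [DecidableEq ι]

theorem fidelity_pureState {ψ : ι → ℂ} (hψ : star ψ ⬝ᵥ ψ = 1) {ρ : Matrix ι ι ℂ} {r : ℝ}
    (hr : 0 ≤ r) (h : star ψ ⬝ᵥ ρ.mulVec ψ = r) : fidelity ρ (pureState ψ) = Real.sqrt r := by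
  have hpos : 0 ≤ pureState ψ := (Matrix.posSemidef_vecMulVec_self_star ψ).nonneg
  have hsq : pureState ψ * pureState ψ = pureState ψ := by
    rw [pureState, Matrix.vecMulVec_mul_vecMulVec, hψ, one_smul]
  have hconj : pureState ψ * ρ * pureState ψ = (r : ℂ) • pureState ψ := by
    rw [pureState, Matrix.vecMulVec_mul, Matrix.vecMulVec_mul_vecMulVec,
      ← Matrix.dotProduct_mulVec, h]
    simp
  have hs1 : CFC.sqrt (pureState ψ) = pureState ψ := CFC.sqrt_unique hsq hpos
  have hs2 : CFC.sqrt ((r : ℂ) • pureState ψ) = ((Real.sqrt r : ℝ) : ℂ) • pureState ψ := by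
    refine CFC.sqrt_unique ?_ ?_
    · rw [smul_mul_smul_comm, hsq]
      congr 1
      exact_mod_cast Real.mul_self_sqrt hr
    · exact smul_nonneg (by exact_mod_cast Real.sqrt_nonneg r) hpos
  have htr : (pureState ψ).trace = 1 := by
    rw [pureState, Matrix.trace_vecMulVec, dotProduct_comm, hψ]
  rw [fidelity, hs1, hconj, hs2, Matrix.trace_smul, htr]
  simp

theorem one_sub_sq_le_sqrt_of_bures_le {ψ : ι → ℂ} (hψ : star ψ ⬝ᵥ ψ = 1) {ρ : Matrix ι ι ℂ}
    {r δ : ℝ} (hr : 0 ≤ r) (h : star ψ ⬝ᵥ ρ.mulVec ψ = r) (hδ : 0 ≤ δ)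
    (hb : bures ρ (pureState ψ) ≤ δ) : 1 - δ ^ 2 ≤ Real.sqrt r := by
  rw [bures, fidelity_pureState hψ hr h, Real.sqrt_le_left hδ] at hb
  linarith

end Fidelity

/-! ### Erasure, recovery and the exchange of erased qubits with the environment. -/

section Erasure

open scoped ComplexOrder

variable {Λ : Type} [Fintype Λ] [DecidableEq Λ]

omit [Fintype Λ] [DecidableEq Λ] in
theorem restrictCfg_eq_iff {S : Finset Λ} {x y : Λ → Fin 2} :
    restrictCfg S x = restrictCfg S y ↔ ∀ i ∈ S, x i = y i :=
  ⟨fun h i hi => congrFun h ⟨i, hi⟩, fun h => funext fun i => h i i.2⟩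

omit [Fintype Λ] in
theorem restrictCfg_flipAt_of_notMem {S : Finset Λ} {i : Λ} (hi : i ∉ S) (x : Λ → Fin 2) :
    restrictCfg S (flipAt i x) = restrictCfg S x :=
  restrictCfg_eq_iff.2 fun _ hj => flipAt_apply_ne (ne_of_mem_of_not_mem hj hi) x

omit [Fintype Λ] in
theorem restrictCfg_flipAt_eq_iff {S : Finset Λ} {i : Λ} {x y : Λ → Fin 2} :
    restrictCfg S (flipAt i x) = restrictCfg S (flipAt i y) ↔
      restrictCfg S x = restrictCfg S y := by
  rw [restrictCfg_eq_iff, restrictCfg_eq_iff]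
  refine forall₂_congr fun j _ => ?_
  by_cases h : j = i
  · subst h; rw [flipAt_apply_self, flipAt_apply_self, sub_right_inj]
  · rw [flipAt_apply_ne h, flipAt_apply_ne h]

/-- A family of Kraus operators that reads off the qubits of `A` and then forgets them produces
operators trivial on `A`. -/
theorem trivialAt_krausMap_of_read {A : Finset Λ} {κ : Type} [Fintype κ]
    {K : Cfg A × κ → Matrix (Λ → Fin 2) (Λ → Fin 2) ℂ}
    (hzero : ∀ a e x y, restrictCfg A y ≠ a → K (a, e) x y = 0)
    (hG : ∀ e x y y', (∀ j ∉ A, y j = y' j) →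
      K (restrictCfg A y, e) x y = K (restrictCfg A y', e) x y')
    (X : Matrix (Λ → Fin 2) (Λ → Fin 2) ℂ) {i : Λ} (hi : i ∈ A) :
    TrivialAt i (krausMap K X) := by
  have key : ∀ y y', krausMap K X y y' =
      if restrictCfg A y = restrictCfg A y' then
        ∑ e, ∑ x, star (K (restrictCfg A y, e) x y) *
          ∑ x', X x x' * K (restrictCfg A y', e) x' y' else 0 := by
    intro y y'
    rw [krausMap_apply, Matrix.sum_apply, Fintype.sum_prod_type,
      Finset.sum_eq_single (restrictCfg A y)]
    · split_ifs with h
      · simp only [Matrix.mul_apply, Matrix.star_apply, h]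
      · refine Finset.sum_eq_zero fun e _ => ?_
        simp [Matrix.mul_apply, hzero (restrictCfg A y) e _ y' (Ne.symm h)]
    · intro a _ ha
      refine Finset.sum_eq_zero fun e _ => ?_
      simp [Matrix.mul_apply, Matrix.star_apply, hzero a e _ y (Ne.symm ha)]
    · simp
  constructor
  · intro y y' h
    rw [key, if_neg fun h' => h (restrictCfg_eq_iff.1 h' i hi)]
  · intro y y'
    have h : ∀ y : Λ → Fin 2, ∀ j ∉ A, flipAt i y j = y j := fun y j hj =>
      flipAt_apply_ne (ne_of_mem_of_not_mem hi hj).symm y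
    rw [key, key]
    simp only [restrictCfg_flipAt_eq_iff, hG _ _ _ _ (h _)]

/-- Replace the labels on `A` by `c`. -/
def overwrite (A : Finset Λ) (c : Cfg A) (x : Λ → Fin 2) : Λ → Fin 2 :=
  fun i => if h : i ∈ A then c ⟨i, h⟩ else x i

omit [Fintype Λ] in
theorem overwrite_of_mem {A : Finset Λ} (c : Cfg A) (x : Λ → Fin 2) {i : Λ} (h : i ∈ A) :
    overwrite A c x i = c ⟨i, h⟩ := dif_pos h

omit [Fintype Λ] in
theorem overwrite_of_notMem {A : Finset Λ} (c : Cfg A) (x : Λ → Fin 2) {i : Λ} (h : i ∉ A) :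
    overwrite A c x i = x i := dif_neg h

omit [Fintype Λ] in
theorem restrictCfg_overwrite {A : Finset Λ} (c : Cfg A) (x : Λ → Fin 2) :
    restrictCfg A (overwrite A c x) = c := funext fun i => overwrite_of_mem c x i.2

omit [Fintype Λ] in
theorem overwrite_restrictCfg {A : Finset Λ} (c : Cfg A) (x : Λ → Fin 2) :
    overwrite A (restrictCfg A x) (overwrite A c x) = x := by
  ext i
  by_cases h : i ∈ A
  · rw [overwrite_of_mem _ _ h]; rfl
  · rw [overwrite_of_notMem _ _ h, overwrite_of_notMem _ _ h]

omit [Fintype Λ] in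
theorem overwrite_flipAt_of_mem {A : Finset Λ} (c : Cfg A) (x : Λ → Fin 2) {i : Λ} (h : i ∈ A) :
    overwrite A c (flipAt i x) = overwrite A c x := by
  ext j
  by_cases hj : j ∈ A
  · rw [overwrite_of_mem _ _ hj, overwrite_of_mem _ _ hj]
  · rw [overwrite_of_notMem _ _ hj, overwrite_of_notMem _ _ hj,
      flipAt_apply_ne (ne_of_mem_of_not_mem h hj).symm]

omit [Fintype Λ] in
theorem overwrite_flipAt_of_notMem {A : Finset Λ} (c : Cfg A) (x : Λ → Fin 2) {i : Λ}
    (h : i ∉ A) : overwrite A c (flipAt i x) = flipAt i (overwrite A c x) := by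
  ext j
  by_cases hj : j ∈ A
  · rw [flipAt_apply_ne (ne_of_mem_of_not_mem hj h), overwrite_of_mem _ _ hj, overwrite_of_mem _ _ hj]
  · rw [overwrite_of_notMem _ _ hj]
    by_cases hij : j = i
    · subst hij; rw [flipAt_apply_self, flipAt_apply_self, overwrite_of_notMem _ _ hj]
    · rw [flipAt_apply_ne hij, flipAt_apply_ne hij, overwrite_of_notMem _ _ hj]

/-- Exchange the register holding the erased labels with the qubits of `A`. -/
def swapEquiv (A : Finset Λ) (κ : Type) :
    (Cfg A × κ) × (Λ → Fin 2) ≃ (Cfg A × κ) × (Λ → Fin 2) where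
  toFun p := ((restrictCfg A p.2, p.1.2), overwrite A p.1.1 p.2)
  invFun p := ((restrictCfg A p.2, p.1.2), overwrite A p.1.1 p.2)
  left_inv p := by simp [restrictCfg_overwrite, overwrite_restrictCfg]
  right_inv p := by simp [restrictCfg_overwrite, overwrite_restrictCfg]

/-- The Kraus operators `K` followed by an exchange of the register holding the erased labels with
the qubits of `A`. -/
def swapFamily {A : Finset Λ} {κ : Type} (K : Cfg A × κ → Matrix (Λ → Fin 2) (Λ → Fin 2) ℂ) :
    Cfg A × κ → Matrix (Λ → Fin 2) (Λ → Fin 2) ℂ :=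
  fun p => Matrix.of fun x y => K (restrictCfg A x, p.2) (overwrite A p.1 x) y

omit [Fintype Λ] in
theorem stack_swapFamily {A : Finset Λ} {κ : Type}
    (K : Cfg A × κ → Matrix (Λ → Fin 2) (Λ → Fin 2) ℂ) :
    stack (swapFamily K) = (stack K).submatrix (swapEquiv A κ) id := rfl

theorem norm_submatrix_equiv {m n : Type*} [Fintype m] [Fintype n] [DecidableEq n]
    (M : Matrix m n ℂ) (e : m ≃ m) : ‖M.submatrix e id‖ = ‖M‖ := by
  have h1 := Matrix.l2_opNorm_conjTranspose_mul_self (M.submatrix e id)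
  have h2 := Matrix.l2_opNorm_conjTranspose_mul_self M
  rw [Matrix.conjTranspose_submatrix, Matrix.submatrix_mul_equiv, Matrix.submatrix_id_id, h2] at h1
  exact ((mul_self_inj (norm_nonneg _) (norm_nonneg _)).1 h1).symm

theorem sum_swapFamily {A : Finset Λ} {κ : Type} [Fintype κ]
    (K : Cfg A × κ → Matrix (Λ → Fin 2) (Λ → Fin 2) ℂ) :
    ∑ p, star (swapFamily K p) * swapFamily K p = ∑ p, star (K p) * K p := by
  rw [← stack_conjTranspose_mul, ← stack_conjTranspose_mul, stack_swapFamily,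
    Matrix.conjTranspose_submatrix, Matrix.submatrix_mul_equiv, Matrix.submatrix_id_id]

/-- The exchange only permutes the rows of the stacked matrix, so closeness on the code survives it.
-/
theorem norm_stack_swapFamily_sub {A : Finset Λ} {κ : Type} [Fintype κ]
    (K L : Cfg A × κ → Matrix (Λ → Fin 2) (Λ → Fin 2) ℂ)
    (P : Matrix (Λ → Fin 2) (Λ → Fin 2) ℂ) :
    ‖(stack (swapFamily K) - stack (swapFamily L)) * P‖ = ‖(stack K - stack L) * P‖ := by
  rw [← norm_submatrix_equiv ((stack K - stack L) * P) (swapEquiv A κ), stack_swapFamily,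
    stack_swapFamily]
  congr 1

/-- The Kraus operators of the erasure of `A` followed by the operation from `N \ A` to `N` with
Kraus operators `R`. -/
def erasureKraus (A N : Finset Λ) {κ : Type} (R : κ → Matrix (Cfg N) (Cfg (N \ A)) ℂ) :
    Cfg A × κ → Matrix (Λ → Fin 2) (Λ → Fin 2) ℂ :=
  fun p => Matrix.of fun x y =>
    if restrictCfg A y = p.1 ∧ restrictCfg Nᶜ x = restrictCfg Nᶜ y then
      R p.2 (restrictCfg N x) (restrictCfg (N \ A) y) else 0

/-- The labels of the lattice as labels of `A`, of `N \ A` and of the complement of `N`. -/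
def glueEquiv {A N : Finset Λ} (h : A ⊆ N) :
    Cfg A × Cfg (N \ A) × Cfg Nᶜ ≃ (Λ → Fin 2) where
  toFun p := glue A N p.1 p.2.1 p.2.2
  invFun x := (restrictCfg A x, restrictCfg (N \ A) x, restrictCfg Nᶜ x)
  left_inv p := by
    refine Prod.ext ?_ (Prod.ext ?_ ?_) <;> funext ⟨i, hi⟩
    · simp [restrictCfg, glue, hi]
    · simp [restrictCfg, glue, (Finset.mem_sdiff.1 hi).1, (Finset.mem_sdiff.1 hi).2]
    · have h1 := Finset.mem_compl.1 hi
      have h2 : i ∉ A := fun h' => h1 (h h')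
      simp [restrictCfg, glue, h1, h2]
  right_inv x := by
    funext i
    by_cases h1 : i ∈ A
    · simp [restrictCfg, glue, h1]
    · by_cases h2 : i ∈ N <;> simp [restrictCfg, glue, h1, h2]

/-- The labels of the lattice as labels of `N` and of its complement. -/
def splitEquiv (N : Finset Λ) : (Λ → Fin 2) ≃ Cfg N × Cfg Nᶜ where
  toFun x := (restrictCfg N x, restrictCfg Nᶜ x)
  invFun p i := if h : i ∈ N then p.1 ⟨i, h⟩ else p.2 ⟨i, Finset.mem_compl.2 h⟩
  left_inv x := by funext i; by_cases h : i ∈ N <;> simp [restrictCfg, h]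
  right_inv p := by
    refine Prod.ext ?_ ?_ <;> funext ⟨i, hi⟩
    · simp [restrictCfg, hi]
    · simp [restrictCfg, Finset.mem_compl.1 hi]

section

variable {A N : Finset Λ} {κ : Type} {R : κ → Matrix (Cfg N) (Cfg (N \ A)) ℂ}

theorem erasureKraus_read_eq_zero (a : Cfg A) (e : κ) (x y : Λ → Fin 2)
    (h : restrictCfg A y ≠ a) : erasureKraus A N R (a, e) x y = 0 := by
  simp [erasureKraus, h]

theorem erasureKraus_read_congr (hAN : A ⊆ N) (e : κ) (x y y' : Λ → Fin 2)
    (h : ∀ j ∉ A, y j = y' j) :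
    erasureKraus A N R (restrictCfg A y, e) x y = erasureKraus A N R (restrictCfg A y', e) x y' := by
  have h1 : restrictCfg Nᶜ y = restrictCfg Nᶜ y' :=
    restrictCfg_eq_iff.2 fun j hj => h j fun h' => Finset.mem_compl.1 hj (hAN h')
  have h2 : restrictCfg (N \ A) y = restrictCfg (N \ A) y' :=
    restrictCfg_eq_iff.2 fun j hj => h j (Finset.mem_sdiff.1 hj).2
  simp [erasureKraus, h1, h2]

theorem trivialAt_erasureKraus (hAN : A ⊆ N) (p : Cfg A × κ) {i : Λ} (hi : i ∉ N) :
    TrivialAt i (erasureKraus A N R p) where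
  eq_zero x y h := by
    refine if_neg fun h' => h ?_
    exact restrictCfg_eq_iff.1 h'.2 i (Finset.mem_compl.2 hi)
  flip x y := by
    simp only [erasureKraus, Matrix.of_apply, restrictCfg_flipAt_eq_iff,
      restrictCfg_flipAt_of_notMem hi, restrictCfg_flipAt_of_notMem fun h => hi (hAN h),
      restrictCfg_flipAt_of_notMem fun h => hi (Finset.mem_sdiff.1 h).1]

/-- The exchange puts the original qubits of `A` back and sends the recovered ones to the
environment. What remains reads and alters `N \ A` only. -/
theorem trivialAt_swapFamily_erasureKraus (hAN : A ⊆ N) (p : Cfg A × κ) {i : Λ}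
    (hi : i ∉ N \ A) : TrivialAt i (swapFamily (erasureKraus A N R) p) := by
  by_cases hiA : i ∈ A
  · have hiC : i ∉ Nᶜ := fun h => Finset.mem_compl.1 h (hAN hiA)
    constructor
    · intro x y h
      exact erasureKraus_read_eq_zero _ _ _ _ fun h' => h (restrictCfg_eq_iff.1 h' i hiA).symm
    · intro x y
      simp only [swapFamily, erasureKraus, Matrix.of_apply, overwrite_flipAt_of_mem _ _ hiA,
        restrictCfg_flipAt_eq_iff, restrictCfg_flipAt_of_notMem hiC,
        restrictCfg_flipAt_of_notMem hi]
  · have hiN : i ∉ N := fun h => hi (Finset.mem_sdiff.2 ⟨h, hiA⟩)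
    constructor
    · intro x y h
      refine (trivialAt_erasureKraus hAN _ hiN).eq_zero _ _ ?_
      rwa [overwrite_of_notMem _ _ hiA]
    · intro x y
      simp only [swapFamily, Matrix.of_apply, overwrite_flipAt_of_notMem _ _ hiA,
        restrictCfg_flipAt_of_notMem hiA]
      exact (trivialAt_erasureKraus hAN _ hiN).flip _ _

theorem sum_erasureKraus (hAN : A ⊆ N) [Fintype κ]
    (hR : ∑ e, (R e).conjTranspose * R e = 1) :
    ∑ p, star (erasureKraus A N R p) * erasureKraus A N R p = 1 := by
  ext y y'
  have h1 : ∀ β β', ∑ e, ∑ ξ, star (R e ξ β) * R e ξ β' = if β = β' then 1 else 0 := by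
    intro β β'
    have := congrFun (congrFun hR β) β'
    simpa [Matrix.sum_apply, Matrix.mul_apply, Matrix.one_apply] using this
  have h2 : ∀ a e, (star (erasureKraus A N R (a, e)) * erasureKraus A N R (a, e)) y y' =
      if restrictCfg A y = a ∧ restrictCfg A y' = a ∧ restrictCfg Nᶜ y = restrictCfg Nᶜ y' then
        ∑ ξ, star (R e ξ (restrictCfg (N \ A) y)) * R e ξ (restrictCfg (N \ A) y') else 0 := by
    intro a e
    rw [Matrix.mul_apply, ← (splitEquiv N).symm.sum_comp, Fintype.sum_prod_type_right]
    have h3 : ∀ p : Cfg N × Cfg Nᶜ, restrictCfg N ((splitEquiv N).symm p) = p.1 ∧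
        restrictCfg Nᶜ ((splitEquiv N).symm p) = p.2 := fun p =>
      Prod.ext_iff.1 ((splitEquiv N).apply_symm_apply p)
    simp only [Matrix.star_apply, erasureKraus, Matrix.of_apply, h3]
    rw [Finset.sum_eq_single (restrictCfg Nᶜ y)]
    · by_cases ha : restrictCfg A y = a <;> by_cases ha' : restrictCfg A y' = a <;>
        by_cases hc : restrictCfg Nᶜ y = restrictCfg Nᶜ y' <;> simp [ha, ha', hc]
    · intro γ _ hγ
      simp [hγ]
    · simp
  rw [Matrix.sum_apply, Fintype.sum_prod_type, Finset.sum_eq_single (restrictCfg A y)]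
  · simp only [h2, true_and]
    rw [Matrix.one_apply]
    by_cases h : restrictCfg A y' = restrictCfg A y ∧ restrictCfg Nᶜ y = restrictCfg Nᶜ y'
    · simp only [h, and_self, if_true, h1]
      congr 1
      rw [eq_iff_iff]
      refine ⟨fun h' => (glueEquiv hAN).symm.injective ?_, fun h' => by rw [h']⟩
      exact Prod.ext h.1.symm (Prod.ext h' h.2)
    · simp only [h, if_false, Finset.sum_const_zero]
      rw [if_neg]
      rintro rfl
      exact h ⟨rfl, rfl⟩
  · intro a _ ha
    exact Finset.sum_eq_zero fun e _ => by rw [h2, if_neg fun h => ha h.1.symm]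
  · simp

theorem erasureKraus_mulVec (hAN : A ⊆ N) (a : Cfg A) (e : κ) (ψ : (Λ → Fin 2) → ℂ)
    (x : Λ → Fin 2) : (erasureKraus A N R (a, e)).mulVec ψ x =
      ∑ β, R e (restrictCfg N x) β * ψ (glue A N a β (restrictCfg Nᶜ x)) := by
  have h3 : ∀ p, restrictCfg A (glueEquiv hAN p) = p.1 ∧
      restrictCfg (N \ A) (glueEquiv hAN p) = p.2.1 ∧
        restrictCfg Nᶜ (glueEquiv hAN p) = p.2.2 := fun p => by
    have := (glueEquiv hAN).symm_apply_apply p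
    exact ⟨congrArg Prod.fst this, congrArg (fun q => q.2.1) this, congrArg (fun q => q.2.2) this⟩
  rw [Matrix.mulVec, dotProduct, ← (glueEquiv hAN).sum_comp, Fintype.sum_prod_type,
    Finset.sum_eq_single a]
  · rw [Fintype.sum_prod_type]
    refine Finset.sum_congr rfl fun β _ => ?_
    rw [Finset.sum_eq_single (restrictCfg Nᶜ x)]
    · simp [erasureKraus, h3]; exact Or.inl rfl
    · intro γ _ hγ
      simp [erasureKraus, h3, Ne.symm hγ]
    · simp
  · intro b _ hb
    exact Finset.sum_eq_zero fun q _ => by simp [erasureKraus, h3, hb]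
  · simp

end

/-- The scalar Kraus operators `φ`, with the erased labels exchanged with the qubits of `A`. -/
theorem swapFamily_scalar_apply {A : Finset Λ} {κ : Type} (φ : Cfg A × κ → ℂ) (c : Cfg A) (e : κ)
    (x y : Λ → Fin 2) :
    swapFamily (fun p => φ p • (1 : Matrix (Λ → Fin 2) (Λ → Fin 2) ℂ)) (c, e) x y =
      if overwrite A c x = y then φ (restrictCfg A x, e) else 0 := by
  simp [swapFamily, Matrix.one_apply]

theorem trivialAt_swapFamily_scalar {A : Finset Λ} {κ : Type} (φ : Cfg A × κ → ℂ)
    (p : Cfg A × κ) {i : Λ} (hi : i ∉ A) :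
    TrivialAt i (swapFamily (fun p => φ p • (1 : Matrix (Λ → Fin 2) (Λ → Fin 2) ℂ)) p) where
  eq_zero x y h := by
    rw [swapFamily_scalar_apply, if_neg]
    rintro rfl
    exact h (overwrite_of_notMem _ _ hi).symm
  flip x y := by
    rw [swapFamily_scalar_apply, swapFamily_scalar_apply, overwrite_flipAt_of_notMem _ _ hi,
      restrictCfg_flipAt_of_notMem hi]
    simp only [(flipEquiv i).injective.eq_iff, show flipAt i = flipEquiv i from rfl]

/-- The cleaning properties of a single region that can be recovered from its surroundings. -/
theorem RecoverableWithin.cleanable {P : Matrix (Λ → Fin 2) (Λ → Fin 2) ℂ}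
    (hP : IsStarProjection P) {δ : ℝ} (hδ : 0 ≤ δ) {A N : Finset Λ} (hAN : A ⊆ N)
    (h : RecoverableWithin P δ A N) :
    Cleanable P A N ∅ (20 * δ) ∧ Cleanable P A A (N \ A) (20 * δ) := by
  obtain ⟨Φ, hΦ, hrec⟩ := h
  obtain ⟨m, R, hΦR, hR⟩ := hΦ.exists_kraus
  set K := erasureKraus A N R with hKdef
  have hK : ∑ p, star (K p) * K p = 1 := sum_erasureKraus hAN hR
  have hfid : ∀ ψ : (Λ → Fin 2) → ℂ, P.mulVec ψ = ψ → star ψ ⬝ᵥ ψ = 1 →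
      1 - δ ^ 2 ≤ Real.sqrt (∑ i, ‖star ψ ⬝ᵥ (K i).mulVec ψ‖ ^ 2) := by
    intro ψ hψ hψ1
    -- Pure code states with a trivial reference system suffice; superpositions are handled by
    -- `exists_uniform_factor`.
    let ψ' : (Λ → Fin 2) × Fin 1 → ℂ := fun p => ψ p.1
    have hPs : P.conjTranspose = P := hP.isSelfAdjoint
    have hcode : IsCodeState P (pureState ψ) := by
      refine ⟨⟨Matrix.posSemidef_vecMulVec_self_star ψ, ?_⟩, ?_, ?_⟩
      · rw [pureState, Matrix.trace_vecMulVec, dotProduct_comm, hψ1]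
      · rw [pureState, Matrix.mul_vecMulVec, hψ]
      · rw [pureState, Matrix.vecMulVec_mul, ← hPs, ← Matrix.star_mulVec, hψ]
    have htr : traceRight (pureState ψ') = pureState ψ := by
      ext x y
      simp [traceRight, pureState, Matrix.vecMulVec_apply, ψ']
    have hb := hrec _ hcode 1 ψ' htr
    have hψ1' : star ψ' ⬝ᵥ ψ' = 1 := by
      rw [← hψ1]; simp [dotProduct, Fintype.sum_prod_type, ψ']
    refine one_sub_sq_le_sqrt_of_bures_le hψ1' (by positivity) ?_ hδ hb
    have hent : ∀ x y k l, assemble N (ampliation Φ (eraseRegion A N (pureState ψ'))) (x, k) (y, l) =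
        ∑ p, (K p).mulVec ψ x * star ((K p).mulVec ψ y) := by
      intro x y k l
      simp only [assemble, ampliation, Matrix.of_apply, hΦR, Matrix.sum_apply]
      rw [Fintype.sum_prod_type_right]
      refine Finset.sum_congr rfl fun e _ => ?_
      simp only [hKdef, erasureKraus_mulVec hAN, Matrix.mul_apply, Matrix.of_apply, eraseRegion,
        pureState, Matrix.vecMulVec_apply, Matrix.conjTranspose_apply, Pi.star_apply, ψ', star_sum,
        Finset.sum_mul, Finset.mul_sum]
      rw [Finset.sum_comm (s := (Finset.univ : Finset (Cfg A)))]
      refine Finset.sum_congr rfl fun j _ => ?_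
      rw [Finset.sum_comm]
      refine Finset.sum_congr rfl fun a _ => Finset.sum_congr rfl fun i _ => ?_
      rw [star_mul']
      ring
    have hsq : ∀ z : ℂ, ((‖z‖ ^ 2 : ℝ) : ℂ) = z * star z := fun z => by
      rw [Complex.ofReal_pow, ← Complex.mul_conj']; rfl
    have hquad : ∀ M : Matrix ((Λ → Fin 2) × Fin 1) ((Λ → Fin 2) × Fin 1) ℂ,
        star ψ' ⬝ᵥ M.mulVec ψ' = ∑ x, ∑ y, star (ψ x) * (M (x, 0) (y, 0) * ψ y) := fun M => by
      simp [dotProduct, Matrix.mulVec, Fintype.sum_prod_type, Finset.mul_sum, ψ']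
    rw [Complex.ofReal_sum, hquad]
    simp only [hsq, hent]
    simp only [dotProduct, Pi.star_apply, star_sum, star_mul', star_star, Finset.sum_mul,
      Finset.mul_sum]
    rw [Finset.sum_comm, Finset.sum_comm (s := (Finset.univ : Finset (Cfg A × Fin m)))]
    refine Finset.sum_congr rfl fun y _ => ?_
    rw [Finset.sum_comm]
    refine Finset.sum_congr rfl fun p _ => Finset.sum_congr rfl fun x _ => ?_
    ring
  obtain ⟨φ, hφ, hη⟩ := exists_scalar_kraus hK hP hδ hfid
  set L : Cfg A × Fin m → Matrix (Λ → Fin 2) (Λ → Fin 2) ℂ :=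
    fun p => φ p • (1 : Matrix (Λ → Fin 2) (Λ → Fin 2) ℂ) with hLdef
  have hL : ∑ p, star (L p) * L p = 1 := by
    have : ∀ p, star (L p) * L p = (star (φ p) * φ p) • (1 : Matrix (Λ → Fin 2) (Λ → Fin 2) ℂ) := by
      intro p
      simp [hLdef, smul_smul, mul_comm]
    simp only [this]
    rw [← Finset.sum_smul, hφ, one_smul]
  have hLX : ∀ X, krausMap L X = X := by
    intro X
    rw [krausMap_apply]
    have : ∀ p, star (L p) * (X * L p) = (star (φ p) * φ p) • X := by
      intro p
      simp [hLdef, smul_smul, mul_comm]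
    simp only [this]
    rw [← Finset.sum_smul, hφ, one_smul]
  have hKs : ∑ p, star (swapFamily K p) * swapFamily K p = 1 := by rw [sum_swapFamily, hK]
  have hLs : ∑ p, star (swapFamily L p) * swapFamily L p = 1 := by rw [sum_swapFamily, hL]
  have hηs : ‖(stack (swapFamily L) - stack (swapFamily K)) * P‖ ≤ 10 * δ := by
    rw [norm_stack_swapFamily_sub, ← neg_sub, Matrix.neg_mul, norm_neg]
    exact hη
  -- The first map is erasure followed by recovery, close to `krausMap L`, which is the identity.
  -- The second replaces `A` by a fixed state and is close to `krausMap (swapFamily K)`, which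
  -- exactly fixes operators trivial on `N \ A`. Each comparison costs `2 · 10δ`.
  refine ⟨⟨krausMap K, IsUnitalSchwarz.of_krausMap hK, ?_, ?_, ?_⟩,
    ⟨krausMap (swapFamily L), IsUnitalSchwarz.of_krausMap hLs,
      ?_, ?_, ?_⟩⟩
  · exact fun X i hi => trivialAt_krausMap_of_read erasureKraus_read_eq_zero
      (erasureKraus_read_congr hAN) X hi
  · exact fun X i hi hX => hX.map_krausMap fun p => trivialAt_erasureKraus hAN p hi
  · intro X _
    have := norm_krausMap_sub_le hK hL hP hη X
    rw [hLX] at this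
    linarith
  · intro X i hi
    refine trivialAt_krausMap_of_read (fun a e x y hy => ?_) (fun e x y y' hyy => ?_) X hi
    · rw [hLdef, swapFamily_scalar_apply, if_neg]
      rintro rfl
      exact hy (restrictCfg_overwrite _ _)
    · rw [hLdef, swapFamily_scalar_apply, swapFamily_scalar_apply]
      congr 1
      rw [eq_iff_iff, funext_iff, funext_iff]
      refine forall_congr' fun j => ?_
      by_cases hj : j ∈ A
      · rw [overwrite_of_mem _ _ hj, overwrite_of_mem _ _ hj]
        simp [restrictCfg]
      · rw [overwrite_of_notMem _ _ hj, overwrite_of_notMem _ _ hj, hyy j hj]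
  · exact fun X i hi hX => hX.map_krausMap fun p => trivialAt_swapFamily_scalar φ p hi
  · intro X hX
    have h1 : krausMap (swapFamily K) X = X := by
      rw [krausMap_apply]
      have : ∀ p, X * swapFamily K p = swapFamily K p * X := fun p =>
        TrivialAt.commute hX fun i hi => trivialAt_swapFamily_erasureKraus hAN p hi
      simp only [this, ← mul_assoc]
      rw [← Finset.sum_mul, hKs, one_mul]
    have := norm_krausMap_sub_le hLs hKs hP hηs X
    rw [h1] at this
    linarith

end Erasure

/-! ### Geometry of boxes -/

section Geometry

variable {D L : ℕ} {bc : Fin D → Bool} {ℓ : ℝ}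

theorem axisDist_le_siteDist (x y : Site D L) (i : Fin D) :
    axisDist (bc i) (x i) (y i) ≤ siteDist bc x y := by
  refine (le_abs_self _).trans ?_
  rw [← Real.sqrt_sq_eq_abs]
  exact Real.sqrt_le_sqrt (Finset.single_le_sum
    (f := fun i => axisDist (bc i) (x i) (y i) ^ 2) (fun i _ => sq_nonneg _) (Finset.mem_univ i))

/-- The last two alternatives describe proximity across the seam of a periodic axis. Natural number
inequalities make the later geometry linear arithmetic for both kinds of axis. -/
theorem axis_close {p : Bool} {a b : Fin L} {t : ℕ} (h : axisDist p a b ≤ t) :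
    ((a : ℕ) ≤ b + t ∧ (b : ℕ) ≤ a + t) ∨ L + a ≤ b + t ∨ L + b ≤ a + t := by
  have key : |((a : ℕ) : ℝ) - ((b : ℕ) : ℝ)| ≤ t → (a : ℕ) ≤ b + t ∧ (b : ℕ) ≤ a + t := by
    intro h
    rw [abs_le] at h
    constructor
    · have : ((a : ℕ) : ℝ) ≤ (b : ℕ) + t := by linarith [h.2]
      exact_mod_cast this
    · have : ((b : ℕ) : ℝ) ≤ (a : ℕ) + t := by linarith [h.1]
      exact_mod_cast this
  rw [axisDist] at h
  split_ifs at h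
  · rcases min_le_iff.1 h with h | h
    · exact Or.inl (key h)
    · right
      rcases abs_cases (((a : ℕ) : ℝ) - ((b : ℕ) : ℝ)) with h' | h'
      · right
        have : (L : ℝ) + (b : ℕ) ≤ (a : ℕ) + t := by linarith [h'.1]
        exact_mod_cast this
      · left
        have : (L : ℝ) + (a : ℕ) ≤ (b : ℕ) + t := by linarith [h'.1]
        exact_mod_cast this
  · exact Or.inl (key h)

theorem exists_close_of_mem_nbhd {A : Finset (Site D L)} {x : Site D L} (hx : x ∈ nbhd bc ℓ A)
    {t : ℕ} (ht : ℓ ≤ t) : ∃ a ∈ A, ∀ i, ((a i : ℕ) ≤ x i + t ∧ (x i : ℕ) ≤ a i + t) ∨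
      L + a i ≤ x i + t ∨ L + x i ≤ a i + t := by
  rw [nbhd, Finset.mem_filter] at hx
  obtain ⟨-, a, ha, h⟩ := hx
  exact ⟨a, ha, fun i => axis_close ((axisDist_le_siteDist a x i).trans (h.trans ht))⟩

theorem siteDist_self (x : Site D L) : siteDist bc x x = 0 := by
  have : ∀ i, axisDist (bc i) (x i) (x i) = 0 := by
    intro i
    rw [axisDist]
    split_ifs <;> simp
  simp [siteDist, this]

theorem subset_nbhd (hℓ : 0 ≤ ℓ) (A : Finset (Site D L)) : A ⊆ nbhd bc ℓ A := fun x hx => by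
  rw [nbhd, Finset.mem_filter]
  exact ⟨Finset.mem_univ _, x, hx, by rwa [siteDist_self]⟩

theorem nbhd_mono {A A' : Finset (Site D L)} (h : A ⊆ A') : nbhd bc ℓ A ⊆ nbhd bc ℓ A' :=
  fun x hx => by
    rw [nbhd, Finset.mem_filter] at hx ⊢
    obtain ⟨h1, a, ha, h2⟩ := hx
    exact ⟨h1, a, h ha, h2⟩

/-- The cube of linear size `s` with lowest corner `p`. -/
def box (D L : ℕ) (p : Fin D → ℕ) (s : ℕ) : Finset (Site D L) :=
  Fintype.piFinset fun i => Finset.univ.filter fun a : Fin L => p i ≤ a ∧ (a : ℕ) < p i + s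

theorem mem_box {p : Fin D → ℕ} {s : ℕ} {x : Site D L} :
    x ∈ box D L p s ↔ ∀ i, p i ≤ x i ∧ (x i : ℕ) < p i + s := by
  simp [box]

theorem card_box {p : Fin D → ℕ} {s : ℕ} (h : ∀ i, p i + s ≤ L) : (box D L p s).card = s ^ D := by
  have key : ∀ i, (Finset.univ.filter fun a : Fin L => p i ≤ a ∧ (a : ℕ) < p i + s).card = s := by
    intro i
    have e : ((Finset.univ.filter fun a : Fin L => p i ≤ a ∧ (a : ℕ) < p i + s).map
        Fin.valEmbedding) = Finset.Ico (p i) (p i + s) := by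
      ext a
      simp only [Finset.mem_map, Finset.mem_filter, Finset.mem_univ, true_and,
        Fin.valEmbedding_apply, Finset.mem_Ico]
      constructor
      · rintro ⟨b, hb, rfl⟩; exact hb
      · intro ha; exact ⟨⟨a, ha.2.trans_le (h i)⟩, ha, rfl⟩
    have := congrArg Finset.card e
    rwa [Finset.card_map, Nat.card_Ico, Nat.add_sub_cancel_left] at this
  rw [box, Fintype.card_piFinset]
  simp [key]

/-- The inner cube keeps a margin `τ` from both ends of each coordinate range, so no wrap-around
occurs. If `s ≤ 2 * τ` the truncated side is zero. -/
theorem nbhd_box_subset {p : Fin D → ℕ} {s τ : ℕ} (hτ : ℓ ≤ τ) (h : ∀ i, p i + s ≤ L) :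
    nbhd bc ℓ (box D L (fun i => p i + τ) (s - 2 * τ)) ⊆ box D L p s := by
  intro x hx
  obtain ⟨a, ha, hc⟩ := exists_close_of_mem_nbhd hx hτ
  rw [mem_box] at ha ⊢
  intro i
  have h1 := ha i
  have h2 := hc i
  have h3 := h i
  have h4 := (x i).2
  omega

theorem box_shrink_subset (p : Fin D → ℕ) (s τ : ℕ) :
    box D L (fun i => p i + τ) (s - 2 * τ) ⊆ box D L p s := by
  intro x hx
  rw [mem_box] at hx ⊢
  intro i
  have := hx i
  omega

theorem pow_succ_le_add {a b : ℕ} (h : b ≤ a) (e : ℕ) :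
    a ^ (e + 1) ≤ b ^ (e + 1) + (e + 1) * (a - b) * a ^ e := by
  obtain ⟨c, rfl⟩ := Nat.exists_eq_add_of_le h
  rw [Nat.add_sub_cancel_left]
  induction e with
  | zero => simp
  | succ e ih =>
    have h1 : b ^ (e + 1) ≤ (b + c) ^ (e + 1) := Nat.pow_le_pow_left h _
    calc (b + c) ^ (e + 1 + 1) = (b + c) ^ (e + 1) * (b + c) := pow_succ _ _
      _ ≤ (b ^ (e + 1) + (e + 1) * c * (b + c) ^ e) * (b + c) := Nat.mul_le_mul_right _ ih
      _ = b ^ (e + 1 + 1) + c * b ^ (e + 1) + (e + 1) * c * (b + c) ^ (e + 1) := by ring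
      _ ≤ b ^ (e + 1 + 1) + c * (b + c) ^ (e + 1) + (e + 1) * c * (b + c) ^ (e + 1) := by gcongr
      _ = b ^ (e + 1 + 1) + (e + 1 + 1) * c * (b + c) ^ (e + 1) := by ring

theorem exists_maximal_pow_lt {C d e : ℕ} (hC : 1 ≤ C) (hd : 1 ≤ d) (he : 1 ≤ e) :
    ∃ w, C * w ^ e < d ∧ d ≤ C * (w + 1) ^ e := by
  have hex : ∃ w, d ≤ C * (w + 1) ^ e :=
    ⟨d, by
      calc d ≤ d + 1 := Nat.le_succ d
        _ ≤ (d + 1) ^ e := Nat.le_self_pow (by omega) _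
        _ ≤ C * (d + 1) ^ e := Nat.le_mul_of_pos_left _ hC⟩
  classical
  refine ⟨Nat.find hex, ?_, Nat.find_spec hex⟩
  rcases h : Nat.find hex with _ | w
  · rw [zero_pow (by omega)]; omega
  · have := Nat.find_min hex (m := w) (by omega)
    omega

end Geometry

/-! ### Cleaning boxes -/

section CleanBoxes

variable {D L : ℕ} {bc : Fin D → Bool} {ℓ : ℝ}
  {P : Matrix (Site D L → Fin 2) (Site D L → Fin 2) ℂ}

/-- The two cleaning properties of a region that can be recovered from its surroundings. -/
def LocallyCleanable (bc : Fin D → Bool) (ℓ : ℝ)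
    (P : Matrix (Site D L → Fin 2) (Site D L → Fin 2) ℂ) (A : Finset (Site D L)) (ε : ℝ) : Prop :=
  Cleanable P A (nbhd bc ℓ A) ∅ ε ∧ Cleanable P A A (nbhd bc ℓ A \ A) ε

theorem LocallyCleanable.mono {A : Finset (Site D L)} {ε ε' : ℝ}
    (h : LocallyCleanable bc ℓ P A ε) (hε : ε ≤ ε') : LocallyCleanable bc ℓ P A ε' :=
  ⟨h.1.mono subset_rfl subset_rfl hε, h.2.mono subset_rfl subset_rfl hε⟩

theorem LocallyCleanable.union (hℓ : 0 ≤ ℓ) {A S : Finset (Site D L)} {ε ε' : ℝ} (hε : 0 ≤ ε)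
    (hε' : 0 ≤ ε') (hA : LocallyCleanable bc ℓ P A ε) (hS : LocallyCleanable bc ℓ P S ε')
    (h : nbhd bc ℓ A ⊆ A ∪ S) : LocallyCleanable bc ℓ P (A ∪ S) (ε + ε') := by
  have hA' : A ⊆ nbhd bc ℓ (A ∪ S) :=
    Finset.subset_union_left.trans (subset_nbhd hℓ _)
  constructor
  -- `S` is cleaned first by its recovery map. The result is trivial on `nbhd A \ A ⊆ S`, as the
  -- replacement map on `A` requires.
  · refine (hA.2.union hε hS.1 Finset.inter_subset_right (B := ∅) subset_rfl ?_).mono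
      (Finset.union_subset hA' (nbhd_mono Finset.subset_union_right)) subset_rfl le_rfl
    intro x hx
    rw [Finset.mem_sdiff] at hx
    have := h hx.1
    simp_all
  · rw [Finset.union_comm A S, add_comm]
    -- Here the roles are reversed: the recovery map of `A` acts first and stays inside `A ∪ S`, and
    -- the replacement map on `S` follows.
    refine (hS.2.union hε' hA.1 Finset.inter_subset_right
      (B := nbhd bc ℓ (S ∪ A) \ (S ∪ A)) (Finset.empty_subset _) ?_).mono
      (Finset.union_subset Finset.subset_union_left ?_) subset_rfl le_rfl
    · intro x hx
      rw [Finset.mem_sdiff] at hx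
      by_cases hxA : x ∈ A
      · exact Finset.mem_union_left _ hxA
      · have h1 : x ∉ nbhd bc ℓ A := fun h' => by
          have := h h'
          simp_all
        have h2 := nbhd_mono (bc := bc) (ℓ := ℓ) (Finset.subset_union_left (s₁ := S) (s₂ := A)) hx.1
        simp_all
    · rw [Finset.union_comm]; exact h

theorem IsCorrectableCode.locallyCleanable (hP : IsStarProjection P) {δ : ℝ} (hδ : 0 ≤ δ)
    (hℓ : 0 ≤ ℓ) {d : ℕ} (h : IsCorrectableCode bc P δ ℓ d) {A : Finset (Site D L)}
    (hA : A.card < d) : LocallyCleanable bc ℓ P A (20 * δ) :=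
  RecoverableWithin.cleanable hP hδ (subset_nbhd hℓ A) (h A hA)

/-- Growing cubes by shells of thickness `τ`. -/
theorem locallyCleanable_box {e : ℕ} {bc : Fin (e + 1) → Bool}
    {P : Matrix (Site (e + 1) L → Fin 2) (Site (e + 1) L → Fin 2) ℂ} (hℓ : 0 ≤ ℓ) {d τ s₀ : ℕ}
    (hτ : ℓ ≤ τ) (hd : 2 * (e + 1) * τ * s₀ ^ e < d) {ε : ℝ} (hε : 0 ≤ ε)
    (h : ∀ A : Finset (Site (e + 1) L), A.card < d → LocallyCleanable bc ℓ P A ε) (k : ℕ) :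
    ∀ (p : Fin (e + 1) → ℕ) (s : ℕ), (∀ i, p i + s ≤ L) → s ≤ s₀ → s < 2 * τ * (k + 1) →
      LocallyCleanable bc ℓ P (box (e + 1) L p s) ((k + 1) * ε) := by
  have hbase : ∀ (p : Fin (e + 1) → ℕ) (s : ℕ), (∀ i, p i + s ≤ L) → s ≤ s₀ → s < 2 * τ →
      LocallyCleanable bc ℓ P (box (e + 1) L p s) ε := by
    intro p s hp hs hsτ
    apply h
    rw [card_box hp]
    calc s ^ (e + 1) = s * s ^ e := pow_succ' _ _
      _ ≤ 2 * τ * s₀ ^ e := by gcongr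
      _ ≤ (e + 1) * (2 * τ * s₀ ^ e) := Nat.le_mul_of_pos_left _ (Nat.succ_pos e)
      _ = 2 * (e + 1) * τ * s₀ ^ e := by ring
      _ < d := hd
  induction k with
  | zero =>
    intro p s hp hs hsτ
    simpa using hbase p s hp hs (by simpa using hsτ)
  | succ k ih =>
    intro p s hp hs hsτ
    have hk : (0 : ℝ) ≤ k := Nat.cast_nonneg k
    by_cases hlt : s < 2 * τ
    · exact (hbase p s hp hs hlt).mono (by push_cast; nlinarith)
    push Not at hlt
    have hA := ih (fun i => p i + τ) (s - 2 * τ) (fun i => by have := hp i; omega) (by omega)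
      (by rw [mul_add, mul_one] at hsτ; omega)
    have hsub := box_shrink_subset (L := L) p s τ
    -- The shell has at most `2 (e + 1) τ s ^ e` sites, fewer than `d`, so it is correctable by
    -- itself.
    have hS : LocallyCleanable bc ℓ P
        (box (e + 1) L p s \ box (e + 1) L (fun i => p i + τ) (s - 2 * τ)) ε := by
      apply h
      rw [Finset.card_sdiff_of_subset hsub, card_box hp,
        card_box fun i => by have := hp i; omega]
      have h1 := pow_succ_le_add (Nat.sub_le s (2 * τ)) e
      have h2 : s - (s - 2 * τ) = 2 * τ := by omega
      rw [h2] at h1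
      have h3 : (e + 1) * (2 * τ) * s ^ e ≤ 2 * (e + 1) * τ * s₀ ^ e := by
        calc (e + 1) * (2 * τ) * s ^ e = 2 * (e + 1) * τ * s ^ e := by ring
          _ ≤ _ := by gcongr
      omega
    have := hA.union hℓ (by positivity) hε hS
      (by rw [Finset.union_sdiff_of_subset hsub]; exact nbhd_box_subset hτ hp)
    rw [Finset.union_sdiff_of_subset hsub] at this
    refine this.mono (le_of_eq ?_)
    push_cast
    ring

/-- The cubes of linear size `s` in a grid with gaps `g`. -/
def gridBox (D L s g : ℕ) {q : ℕ} (v : Fin D → Fin q) : Finset (Site D L) :=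
  box D L (fun i => v i * (s + g)) s

theorem gridBox_add_le {s g q : ℕ} (hq : q * (s + g) ≤ L) (v : Fin D → Fin q) (i : Fin D) :
    v i * (s + g) + (s + g) ≤ L := by
  have h1 : ((v i : ℕ) + 1) * (s + g) ≤ q * (s + g) := Nat.mul_le_mul_right _ (v i).2
  rw [add_mul, one_mul] at h1
  exact h1.trans hq

/-- Each period ends with its gap, so the last and the first cube along a periodic axis are
separated too. -/
theorem notMem_nbhd_gridBox {s g q : ℕ} (hg : ℓ ≤ g) (hq : q * (s + g) ≤ L)
    {u v : Fin D → Fin q} (huv : u ≠ v) {x : Site D L} (hx : x ∈ gridBox D L s g u) :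
    x ∉ nbhd bc ℓ (gridBox D L s g v) := by
  intro hxn
  obtain ⟨a, ha, hc⟩ := exists_close_of_mem_nbhd hxn hg
  obtain ⟨i, hi⟩ := Function.ne_iff.1 huv
  have hx' := mem_box.1 hx i
  have ha' := mem_box.1 ha i
  have hc' := hc i
  have hu := gridBox_add_le hq u i
  have hv := gridBox_add_le hq v i
  have hstep : ∀ m n : ℕ, m < n → m * (s + g) + (s + g) ≤ n * (s + g) := by
    intro m n hmn
    have := Nat.mul_le_mul_right (s + g) (Nat.succ_le_of_lt hmn)
    rwa [Nat.succ_mul] at this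
  rcases lt_or_gt_of_ne (fun h => hi (Fin.ext h) : (u i : ℕ) ≠ v i) with h | h
  · have := hstep _ _ h
    omega
  · have := hstep _ _ h
    omega

theorem card_biUnion_gridBox {s g q : ℕ} (hℓ : 0 ≤ ℓ) (hg : ℓ ≤ g) (hq : q * (s + g) ≤ L) :
    (Finset.univ.biUnion fun v : Fin D → Fin q => gridBox D L s g v).card = q ^ D * s ^ D := by
  rw [Finset.card_biUnion]
  · have hcard : ∀ v : Fin D → Fin q, (gridBox D L s g v).card = s ^ D := fun v =>
      card_box fun i => by have := gridBox_add_le hq v i; omega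
    simp [hcard]
  · intro u _ v _ huv
    rw [Function.onFun, Finset.disjoint_left]
    exact fun x hx hx' => notMem_nbhd_gridBox (bc := fun _ => false) hg hq huv hx
      (subset_nbhd hℓ _ hx')

theorem cleanable_biUnion_gridBox {s g q : ℕ} (hg : ℓ ≤ g) (hq : q * (s + g) ≤ L) {ε : ℝ}
    (hε : 0 ≤ ε)
    (h : ∀ v : Fin D → Fin q, Cleanable P (gridBox D L s g v) (nbhd bc ℓ (gridBox D L s g v)) ∅ ε)
    (V : Finset (Fin D → Fin q)) :
    Cleanable P (V.biUnion fun v => gridBox D L s g v)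
      (V.biUnion fun v => nbhd bc ℓ (gridBox D L s g v)) ∅ (V.card * ε) := by
  classical
  induction V using Finset.induction_on with
  | empty => simpa using Cleanable.empty
  | insert v V hv ih =>
    rw [Finset.biUnion_insert, Finset.biUnion_insert, Finset.card_insert_of_notMem hv]
    refine ((h v).union hε ih ?_ (B := ∅) subset_rfl (Finset.empty_subset _)).mono subset_rfl
      subset_rfl (le_of_eq (by push_cast; ring))
    intro x hx
    rw [Finset.mem_inter, Finset.mem_biUnion] at hx
    obtain ⟨⟨u, hu, hxu⟩, hxn⟩ := hx
    exact absurd hxn (notMem_nbhd_gridBox hg hq (ne_of_mem_of_not_mem hu hv) hxu)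

end CleanBoxes

/-- The combinatorial core: a large cleanable region. -/
theorem exists_cleanable_compl {e L : ℕ} (he : 1 ≤ e) {bc : Fin (e + 1) → Bool} {ℓ : ℝ}
    {P : Matrix (Site (e + 1) L → Fin 2) (Site (e + 1) L → Fin 2) ℂ} (hℓ : 0 ≤ ℓ) {d t w : ℕ}
    (ht : ℓ ≤ t) (ht1 : 1 ≤ t) (hd1 : 1 ≤ d) (hdL : d ≤ L ^ (e + 1))
    (hw : 2 * (e + 1) * t * w ^ e < d) (hw' : d ≤ 2 * (e + 1) * t * (w + 1) ^ e)
    {ε : ℝ} (hε : 0 ≤ ε)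
    (h : ∀ A : Finset (Site (e + 1) L), A.card < d → LocallyCleanable bc ℓ P A ε) :
    ∃ (Y N : Finset (Site (e + 1) L)) (r : ℕ),
      Y.card * (w + 1) ≤ 8 * (e + 1) * t * L ^ (e + 1) ∧
        d * r ≤ (e + 1) * 4 ^ (e + 1) * L ^ (e + 1) ∧ Cleanable P Yᶜ N ∅ (r * ε) := by
  -- Cubes too small compared with the gaps: the bound on `Y` is weak enough to allow the whole
  -- lattice, with no cleaning.
  rcases lt_or_ge w (4 * t) with hw4 | hw4
  · refine ⟨Finset.univ, ∅, 0, ?_, by simp, by simpa using Cleanable.empty⟩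
    rw [Finset.card_univ]
    simp only [Fintype.card_pi, Fintype.card_fin, Finset.prod_const, Finset.card_univ]
    calc L ^ (e + 1) * (w + 1) ≤ L ^ (e + 1) * (8 * (e + 1) * t) := by
          gcongr; nlinarith
      _ = _ := by ring
  have hL : 1 ≤ L := by
    by_contra hL
    have : L = 0 := by omega
    rw [this, zero_pow (Nat.succ_ne_zero e)] at hdL
    omega
  rcases lt_or_ge w L with hwL | hwL
  -- Rounding up the number `q` of cubes per axis makes the period `r = L / q` less than `w`, with
  -- fewer than `q` sites left over per axis. From `4 * t ≤ w` and `q * w ≤ 2 * L` follows `2 * t ≤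
  -- r`, so the cube side `s = r - t` is at least the gap `t`.
  · set q := L / w + 1 with hq
    set r := L / q with hr
    have hw0 : 0 < w := by omega
    have hq0 : 0 < q := Nat.succ_pos _
    have hqw : q * w ≤ 2 * L := by
      have := Nat.div_mul_le_self L w
      rw [hq, add_mul]; omega
    have hLq : L < q * w := by
      have := Nat.lt_mul_div_succ L hw0
      rw [hq, mul_comm]; exact this
    have hqr : q * r ≤ L := Nat.mul_div_le L q
    have hLr : L < q * r + q := by
      have := Nat.lt_mul_div_succ L hq0
      rw [mul_add, mul_one] at this; exact this
    have hrw : r < w := lt_of_mul_lt_mul_left (hqr.trans_lt hLq) (Nat.zero_le q)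
    have hrt : 2 * t ≤ r := by
      rw [hr, Nat.le_div_iff_mul_le hq0]
      nlinarith
    obtain ⟨s, hs⟩ : ∃ s, r = s + t := ⟨r - t, by omega⟩
    have hst : t ≤ s := by omega
    have hqs : q * (s + t) ≤ L := by rw [← hs]; exact hqr
    have hbox : ∀ v : Fin (e + 1) → Fin q, Cleanable P (gridBox (e + 1) L s t v)
        (nbhd bc ℓ (gridBox (e + 1) L s t v)) ∅ (((s / (2 * t) : ℕ) + 1) * ε) := fun v =>
      (locallyCleanable_box hℓ ht hw hε h (s / (2 * t)) _ s
        (fun i => by have := gridBox_add_le hqs v i; omega) (by omega)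
        (Nat.lt_mul_div_succ s (by omega))).1
    have hclean := cleanable_biUnion_gridBox ht hqs (by positivity) hbox Finset.univ
    refine ⟨(Finset.univ.biUnion fun v : Fin (e + 1) → Fin q => gridBox (e + 1) L s t v)ᶜ,
      Finset.univ.biUnion fun v : Fin (e + 1) → Fin q => nbhd bc ℓ (gridBox (e + 1) L s t v),
      q ^ (e + 1) * (s / (2 * t) + 1), ?_, ?_, ?_⟩
    · rw [Finset.card_compl, card_biUnion_gridBox hℓ ht hqs, ← mul_pow]
      simp only [Fintype.card_pi, Fintype.card_fin, Finset.prod_const, Finset.card_univ]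
      have hqsL : q * s ≤ L := (Nat.mul_le_mul_left q (by omega)).trans hqs
      have h1 := pow_succ_le_add hqsL e
      have h2 : L - q * s ≤ 2 * (q * t) := by
        have : q ≤ q * t := Nat.le_mul_of_pos_right q ht1
        rw [hs, mul_add] at hLr
        omega
      calc (L ^ (e + 1) - (q * s) ^ (e + 1)) * (w + 1)
          ≤ ((e + 1) * (2 * (q * t)) * L ^ e) * (2 * w) := by
            refine Nat.mul_le_mul ?_ (by omega)
            have : (e + 1) * (L - q * s) * L ^ e ≤ (e + 1) * (2 * (q * t)) * L ^ e := by gcongr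
            omega
        _ = 4 * (e + 1) * t * L ^ e * (q * w) := by ring
        _ ≤ 4 * (e + 1) * t * L ^ e * (2 * L) := by gcongr
        _ = _ := by ring
    · have h1 : t * (s / (2 * t) + 1) ≤ 2 * s := by
        have := Nat.mul_div_le s (2 * t)
        nlinarith
      calc d * (q ^ (e + 1) * (s / (2 * t) + 1))
          ≤ (2 * (e + 1) * t * (2 * w) ^ e) * (q ^ (e + 1) * (s / (2 * t) + 1)) := by
            gcongr
            refine hw'.trans ?_
            gcongr
            omega
        _ = 2 * (e + 1) * 2 ^ e * (q * w) ^ e * q * (t * (s / (2 * t) + 1)) := by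
            rw [mul_pow, mul_pow, pow_succ]; ring
        _ ≤ 2 * (e + 1) * 2 ^ e * (2 * L) ^ e * q * (2 * s) := by gcongr
        _ = 4 * (e + 1) * (2 ^ e * 2 ^ e) * L ^ e * (q * s) := by rw [mul_pow]; ring
        _ ≤ 4 * (e + 1) * (2 ^ e * 2 ^ e) * L ^ e * L := by
            gcongr
            exact (Nat.mul_le_mul_left q (by omega)).trans hqs
        _ = _ := by rw [← mul_pow]; ring
    · rw [compl_compl]
      refine hclean.mono subset_rfl subset_rfl (le_of_eq ?_)
      simp only [Finset.card_univ, Fintype.card_pi, Fintype.card_fin, Finset.prod_const]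
      push_cast
      ring
  -- The whole lattice is one growable cube. Shells of thickness `t` could be too many for the bound
  -- on `d * r`, so the thickest shells still smaller than `d` are used.
  · obtain ⟨τ, hτ, hτ'⟩ := exists_maximal_pow_lt (C := 2 * (e + 1) * L ^ e) (d := d) (e := 1)
      (Nat.mul_pos (by omega) (by positivity)) hd1 le_rfl
    rw [pow_one] at hτ hτ'
    have htτ : t ≤ τ := by
      by_contra hcon
      have h1 : 2 * (e + 1) * L ^ e * (τ + 1) ≤ 2 * (e + 1) * t * w ^ e := by
        calc 2 * (e + 1) * L ^ e * (τ + 1) ≤ 2 * (e + 1) * w ^ e * t := by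
              gcongr; omega
          _ = _ := by ring
      omega
    have hτ1 : 1 ≤ τ := ht1.trans htτ
    have hbox := (locallyCleanable_box (bc := bc) (P := P) (s₀ := L) hℓ
      (ht.trans (by exact_mod_cast htτ)) (by rw [mul_right_comm]; exact hτ) hε h (L / (2 * τ))
      (fun _ => 0) L (fun i => by simp) le_rfl (Nat.lt_mul_div_succ L (by omega))).1
    refine ⟨∅, nbhd bc ℓ (box (e + 1) L (fun _ => 0) L), L / (2 * τ) + 1, by simp, ?_, ?_⟩
    · have h1 : 2 * τ * (L / (2 * τ)) ≤ L := Nat.mul_div_le L (2 * τ)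
      have h2 : d ≤ 2 * (e + 1) * L ^ e * (2 * τ) := hτ'.trans (by gcongr; omega)
      calc d * (L / (2 * τ) + 1) = d * (L / (2 * τ)) + d := by ring
        _ ≤ 2 * (e + 1) * L ^ e * (2 * τ) * (L / (2 * τ)) + L ^ (e + 1) := by gcongr
        _ = 2 * (e + 1) * L ^ e * (2 * τ * (L / (2 * τ))) + L ^ (e + 1) := by ring
        _ ≤ 2 * (e + 1) * L ^ e * L + L ^ (e + 1) := by gcongr
        _ = (2 * (e + 1) + 1) * L ^ (e + 1) := by ring
        _ ≤ (e + 1) * 4 ^ (e + 1) * L ^ (e + 1) := by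
          gcongr
          have : 4 ≤ 4 ^ (e + 1) := Nat.le_self_pow (by omega) 4
          nlinarith
    · have huniv : (∅ : Finset (Site (e + 1) L))ᶜ = box (e + 1) L (fun _ => 0) L := by
        ext x
        simp [mem_box]
      rw [huniv]
      exact_mod_cast hbox

/-- The size bound of the region, in terms of a root of the distance. -/
theorem card_mul_rpow_le {e : ℕ} (he : 1 ≤ e) {y d t w n : ℕ} {ℓ : ℝ} (hℓ : 1 ≤ ℓ)
    (ht : (t : ℝ) ≤ 2 * ℓ) (hd : d ≤ 2 * (e + 1) * t * (w + 1) ^ e)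
    (hy : y * (w + 1) ≤ 8 * (e + 1) * t * n) :
    (y : ℝ) * (d : ℝ) ^ ((1 : ℝ) / e) ≤
      64 * (e + 1) ^ 2 * (n * ℓ ^ (((e : ℝ) + 1) / e)) := by
  have he0 : (0 : ℝ) < e := by exact_mod_cast he
  have hinv : (0 : ℝ) ≤ 1 / (e : ℝ) := by positivity
  have hinv1 : 1 / (e : ℝ) ≤ 1 := by
    rw [div_le_one he0]; exact_mod_cast he
  have hℓ0 : (0 : ℝ) ≤ ℓ := by linarith
  have h1 : (d : ℝ) ^ ((1 : ℝ) / e) ≤ 4 * (e + 1) * ℓ ^ ((1 : ℝ) / e) * (w + 1) := by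
    have hd' : (d : ℝ) ≤ (4 * (e + 1) * ℓ) * (w + 1) ^ e := by
      have : (d : ℝ) ≤ 2 * (e + 1) * t * (w + 1) ^ e := by exact_mod_cast hd
      refine this.trans (mul_le_mul_of_nonneg_right ?_ (by positivity))
      nlinarith
    calc (d : ℝ) ^ ((1 : ℝ) / e) ≤ ((4 * (e + 1) * ℓ) * (w + 1) ^ e) ^ ((1 : ℝ) / e) :=
          Real.rpow_le_rpow (by positivity) hd' hinv
      _ = (4 * ((e : ℝ) + 1)) ^ ((1 : ℝ) / e) * ℓ ^ ((1 : ℝ) / e) * (w + 1) := by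
          rw [Real.mul_rpow (by positivity) (by positivity),
            Real.mul_rpow (by positivity) (by positivity), one_div,
            Real.pow_rpow_inv_natCast (by positivity) (by omega)]
      _ ≤ _ := by
          gcongr
          exact Real.rpow_le_self_of_one_le (by nlinarith) hinv1
  have h2 : ℓ ^ (((e : ℝ) + 1) / e) = ℓ * ℓ ^ ((1 : ℝ) / e) := by
    rw [add_div, div_self he0.ne', Real.rpow_add (by linarith), Real.rpow_one]
  have hy' : (y : ℝ) * (w + 1) ≤ 8 * (e + 1) * t * n := by exact_mod_cast hy
  rw [h2]
  have hp : (0 : ℝ) ≤ ℓ ^ ((1 : ℝ) / e) := by positivity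
  calc (y : ℝ) * (d : ℝ) ^ ((1 : ℝ) / e)
      ≤ y * (4 * (e + 1) * ℓ ^ ((1 : ℝ) / e) * (w + 1)) := by gcongr
    _ = 4 * (e + 1) * ℓ ^ ((1 : ℝ) / e) * (y * (w + 1)) := by ring
    _ ≤ 4 * (e + 1) * ℓ ^ ((1 : ℝ) / e) * (8 * (e + 1) * (2 * ℓ) * n) := by
        refine mul_le_mul_of_nonneg_left (hy'.trans ?_) (by positivity)
        gcongr
    _ = _ := by ring

end LocalCode

/-- Here `‖·‖` is the operator norm of matrices (largest singular value). -/
theorem mainTheorem2 (D : ℕ) (hD : 2 ≤ D) :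
    ∃ c c' : ℝ, 0 < c ∧ 0 < c' ∧
      ∀ (L : ℕ) (bc : Fin D → Bool)
        (P : Matrix (LocalCode.Site D L → Fin 2) (LocalCode.Site D L → Fin 2) ℂ)
        (δ ℓ : ℝ) (d : ℕ),
        IsStarProjection P → 0 ≤ δ → 1 ≤ ℓ → 1 ≤ d → d ≤ L ^ D →
        LocalCode.IsCorrectableCode bc P δ ℓ d →
        ∃ Y : Finset (LocalCode.Site D L),
          (Y.card : ℝ) * (d : ℝ) ^ ((1 : ℝ) / ((D : ℝ) - 1)) ≤
              c' * ((L : ℝ) ^ D * ℓ ^ ((D : ℝ) / ((D : ℝ) - 1))) ∧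
          ∀ U : Matrix (LocalCode.Site D L → Fin 2) (LocalCode.Site D L → Fin 2) ℂ,
            LocalCode.IsLogical P U → ‖U‖ ≤ 1 →
            ∃ V : Matrix (LocalCode.Site D L → Fin 2) (LocalCode.Site D L → Fin 2) ℂ,
              LocalCode.SupportedOn Y V ∧
              ‖(U - V) * P‖ ≤ c * Real.sqrt ((L : ℝ) ^ D * δ / (d : ℝ)) := by
  obtain ⟨e, rfl⟩ : ∃ e, D = e + 1 := ⟨D - 1, by omega⟩
  have he : 1 ≤ e := by omega
  -- The factor `60` is `3 · 20`: three terms in the Schwarz estimate, and error `20δ` for each of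
  -- the `r` cleaning steps.
  refine ⟨Real.sqrt (60 * (e + 1) * 4 ^ (e + 1)), 64 * (e + 1) ^ 2, by positivity, by positivity,
    fun L bc P δ ℓ d hP hδ hℓ hd hdL hcode => ?_⟩
  have hℓ0 : 0 ≤ ℓ := by linarith
  have ht1 : 1 ≤ ⌈ℓ⌉₊ := Nat.one_le_ceil_iff.2 (by linarith)
  have ht2 : (⌈ℓ⌉₊ : ℝ) ≤ 2 * ℓ := by
    have := Nat.ceil_lt_add_one hℓ0
    linarith
  obtain ⟨w, hw, hw'⟩ := LocalCode.exists_maximal_pow_lt (C := 2 * (e + 1) * ⌈ℓ⌉₊)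
    (Nat.mul_pos (by omega) ht1) hd he
  obtain ⟨Y, N, r, hY, hr, hclean⟩ := LocalCode.exists_cleanable_compl he hℓ0 (Nat.le_ceil ℓ) ht1
    hd hdL hw hw' (by positivity : (0 : ℝ) ≤ 20 * δ)
    fun A hA => hcode.locallyCleanable hP hδ hℓ0 hA
  refine ⟨Y, ?_, fun U hU hU1 => ?_⟩
  · have := LocalCode.card_mul_rpow_le he hℓ ht2 hw' hY
    push_cast at this ⊢
    rwa [add_sub_cancel_right]
  · obtain ⟨V, hV, hUV⟩ := hclean.exists_supportedOn (Y := Y) hP (by positivity)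
      (fun i hi => Finset.mem_compl.2 hi) hU hU1
    refine ⟨V, hV, hUV.trans ?_⟩
    rw [← Real.sqrt_mul (by positivity)]
    apply Real.sqrt_le_sqrt
    have hd0 : (0 : ℝ) < d := by exact_mod_cast hd
    have hr' : (d : ℝ) * r ≤ (e + 1) * 4 ^ (e + 1) * L ^ (e + 1) := by exact_mod_cast hr
    rw [← mul_div_assoc, le_div_iff₀ hd0]
    calc 3 * (r * (20 * δ)) * d = 60 * δ * (d * r) := by ring
      _ ≤ 60 * δ * ((e + 1) * 4 ^ (e + 1) * L ^ (e + 1)) := by gcongr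
      _ = _ := by ring
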